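/- Let $(M,g)$ be an oriented smooth 4-dimensional Lorentzian manifold of signature $(-+++)$ with Levi-Civita volume form $\varepsilon_{\alpha\beta\gamma\delta}$, and let $\nabla$ be a smooth affine connection on $M$ with $\nabla g=0$, coefficients $C^\gamma_{\alpha\beta}$ (so $\nabla_\alpha Y^\gamma=\partial_\alpha Y^\gamma+C^\gamma_{\alpha\beta}Y^\beta$) and torsion $S_{\alpha\beta}{}^\gamma=C^\gamma_{[\alpha\beta]}$. Let $R_{\alpha\beta\gamma}{}^\rho=\partial_\beta C^\rho_{\alpha\gamma}-\partial_\alpha C^\rho_{\beta\gamma}+C^\rho_{\beta\sigma}C^\sigma_{\alpha\gamma}-C^\rho_{\alpha\sigma}C^\sigma_{\beta\gamma}$, $R_{\alpha\beta}=R_{\alpha\mu\beta}{}^\mu$, $R=R_\mu{}^\mu$ be its Riemann tensor, Ricci tensor and Ricci scalar. Let $u$ be a smooth vector field on $M$ with $u_\alpha u^\alpha=-1$. Put $h_{\alpha\beta}=g_{\alpha\beta}+u_\alpha u_\beta$, $\varepsilon_{\alpha\beta\gamma}=\varepsilon_{\alpha\beta\gamma\sigma}u^\sigma$, $S_{\alpha\beta}=-h_\alpha{}^\mu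 h_\beta{}^\nu u^\sigma S_{\mu\nu\sigma}$, and define the torsion vector $S^\gamma=\tfrac12\varepsilon^{\gamma\mu\nu}S_{\mu\nu}$. With $B_\beta{}^\alpha=\nabla_\beta u^\alpha+2S_{\gamma\beta}{}^\alpha u^\gamma$ and $B_{\perp\alpha\beta}=h_\alpha{}^\gamma h_\beta{}^\sigma B_{\gamma\sigma}$, let $\theta=B_{\perp\gamma}{}^\gamma$, $\sigma_{\alpha\beta}=B_{\perp(\alpha\beta)}-\tfrac13h_{\alpha\beta}\theta$ and $\omega_{\alpha\beta}=B_{\perp[\alpha\beta]}$ be the expansion, shear and vorticity of $u$; for a function $f$ let $D_\alpha f=h_\alpha{}^\beta\partial_\beta f$. Suppose that the Einstein–Cartan field equations with cosmological constant $\Lambda$ hold for a Weyssenhoff fluid with 4-velocity $u$, that is, $$R_{\alpha\beta}-\tfrac12g_{\alpha\beta}R+\Lambda g_{\alpha\beta}=8\pi\left(\mu u_\alpha u_\beta+p\,h_{\alpha\beta}+q_\alpha u_\beta\right),\qquad S^{\alpha\beta\gamma}+2g^{\gamma[\alpha}S^{\beta]}{}_\mu{}^\mu=\Delta^{\alpha\beta}u^\gamma,$$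 for smooth functions $\mu,p$ on $M$, a vector field $q$ with $q_\alpha u^\alpha=0$ and an antisymmetric tensor field $\Delta^{\alpha\beta}$ with $\Delta^{\alpha\beta}u_\beta=0$. Suppose moreover that $\sigma_{\alpha\beta}=0$, $D_\alpha\theta=0$, $D_\alpha\mu=0$, $D_\alpha p=0$, $u^\beta\nabla_\beta u^\alpha=0$ and $\omega_{\alpha\beta}=S_{\alpha\beta}$ on $M$. Let $V$ be a simply connected hypersurface of $M$ without boundary that is everywhere orthogonal to $u$. If $S_\alpha S^\alpha\neq0$ at every point of $V$, then $V$ is not closed, i.e. not compact. -/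

import Mathlib

open scoped Manifold ContDiff Bundle

namespace EinsteinCartan

noncomputable section

universe v w

/-- The diagonal of the Minkowski metric, signature `(- + + +)`. -/
def eta (i : Fin 4) : ℝ := if i = 0 then -1 else 1

/-- A smooth Lorentzian metric, of signature `(- + + +)`, on a smooth 4-manifold. -/
structure LorentzMetric (M : Type v) [TopologicalSpace M]
    [ChartedSpace (EuclideanSpace ℝ (Fin 4)) M] [IsManifold (𝓡 4) ∞ M] where
  /-- the scalar product `g_x` on the tangent space at `x` -/
  val : ∀ x : M, TangentSpace (𝓡 4) x →L[ℝ] TangentSpace (𝓡 4) x →L[ℝ] ℝ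
  smooth : ContMDiff (𝓡 4)
    ((𝓡 4).prod 𝓘(ℝ, EuclideanSpace ℝ (Fin 4) →L[ℝ] EuclideanSpace ℝ (Fin 4) →L[ℝ] ℝ)) ∞
    (fun x ↦ Bundle.TotalSpace.mk'
      (EuclideanSpace ℝ (Fin 4) →L[ℝ] EuclideanSpace ℝ (Fin 4) →L[ℝ] ℝ)
      (E := fun x : M ↦ TangentSpace (𝓡 4) x →L[ℝ] TangentSpace (𝓡 4) x →L[ℝ] ℝ) x (val x))
  symm : ∀ (x : M) (a b : TangentSpace (𝓡 4) x), val x a b = val x b a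
  exists_orthonormal : ∀ x : M, ∃ e : Module.Basis (Fin 4) ℝ (TangentSpace (𝓡 4) x),
    ∀ i j, val x (e i) (e j) = if i = j then eta i else 0

/-- An oriented 4-dimensional Lorentzian manifold with a smooth metric compatible affine
connection; the torsion of the connection is arbitrary. -/
structure RiemannCartan (M : Type v) [TopologicalSpace M]
    [ChartedSpace (EuclideanSpace ℝ (Fin 4)) M] [IsManifold (𝓡 4) ∞ M] where
  /-- the metric -/
  g : LorentzMetric M
  /-- the Levi-Civita volume form `ε_{αβγδ}` of the metric and the orientation -/
  vol : ∀ x : M, TangentSpace (𝓡 4) x [⋀^Fin 4]→ₗ[ℝ] ℝ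
  /-- `ε` takes the values `± √|det g|`. -/
  vol_sq : ∀ (x : M) (a : Fin 4 → TangentSpace (𝓡 4) x),
    (vol x a) ^ 2 = -(Matrix.of fun i j ↦ g.val x (a i) (a j)).det
  /-- `ε` is a smooth 4-form: this makes the choice of sign an orientation of the manifold. -/
  vol_smooth : ∀ (X : Fin 4 → ∀ x : M, TangentSpace (𝓡 4) x) (x : M),
    (∀ i, ContMDiffAt (𝓡 4) (𝓡 4).tangent ∞ (fun y ↦ (X i y : TangentBundle (𝓡 4) M)) x) →
    ContMDiffAt (𝓡 4) 𝓘(ℝ) ∞ (fun y ↦ vol y fun i ↦ X i y) x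
  /-- the connection: `nabla Y x a` is `∇_a Y` at `x` -/
  nabla : CovariantDerivative (𝓡 4) (EuclideanSpace ℝ (Fin 4))
    (TangentSpace (𝓡 4) : M → Type _)
  nabla_smooth : nabla.ContMDiffCovariantDerivative ∞
  nabla_metric : ∀ (Y Z : ∀ x : M, TangentSpace (𝓡 4) x) (x : M),
    MDifferentiableAt (𝓡 4) (𝓡 4).tangent (fun y ↦ (Y y : TangentBundle (𝓡 4) M)) x →
    MDifferentiableAt (𝓡 4) (𝓡 4).tangent (fun y ↦ (Z y : TangentBundle (𝓡 4) M)) x →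
    ∀ a : TangentSpace (𝓡 4) x,
      mfderiv (𝓡 4) 𝓘(ℝ) (fun y ↦ g.val y (Y y) (Z y)) x a
        = g.val x (nabla Y x a) (Z x) + g.val x (Y x) (nabla Z x a)

section Geometry

variable {M : Type v} [TopologicalSpace M]
  [ChartedSpace (EuclideanSpace ℝ (Fin 4)) M] [IsManifold (𝓡 4) ∞ M]

namespace RiemannCartan

variable (G : RiemannCartan M)

/-- An orthonormal basis of the tangent space at `x`, used to write contractions. Every
contraction below is one of tensors, so it does not depend on the choice. -/
def frame (x : M) : Module.Basis (Fin 4) ℝ (TangentSpace (𝓡 4) x) :=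
  Classical.choose (G.g.exists_orthonormal x)

/-- The torsion tensor `S_{αβ}{}^γ = C_{[αβ]}{}^γ`, applied to two vectors: half of
`∇_X Y - ∇_Y X - [X, Y]`. -/
def torsionTensor (x : M) (a b : TangentSpace (𝓡 4) x) : TangentSpace (𝓡 4) x :=
  (1 / 2 : ℝ) • G.nabla.torsion x a b

/-- The trace `S_{αμ}{}^μ` of the torsion tensor. -/
def torsionTrace (x : M) (a : TangentSpace (𝓡 4) x) : ℝ :=
  ∑ i, eta i * G.g.val x (G.torsionTensor x a (G.frame x i)) (G.frame x i)

/-- The curvature operator of the connection on vector fields, with the sign convention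
`R(X, Y) Z = ∇_Y ∇_X Z - ∇_X ∇_Y Z + ∇_[X, Y] Z`. -/
def curvature (X Y Z : ∀ x : M, TangentSpace (𝓡 4) x) (x : M) : TangentSpace (𝓡 4) x :=
  G.nabla (fun y ↦ G.nabla Z y (X y)) x (Y x) - G.nabla (fun y ↦ G.nabla Z y (Y y)) x (X x)
    + G.nabla Z x (VectorField.mlieBracket (𝓡 4) X Y x)

/-- The Riemann tensor `R_{αβγ}{}^ρ` applied to three vectors at `x`, which are extended to a
neighbourhood of `x` as vector fields with constant coordinates in the preferred chart at `x`.
In that chart this is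
`∂_β C_{αγ}^ρ - ∂_α C_{βγ}^ρ + C_{βσ}^ρ C_{αγ}^σ - C_{ασ}^ρ C_{βγ}^σ`. -/
def riemann (x : M) (a b c : TangentSpace (𝓡 4) x) : TangentSpace (𝓡 4) x :=
  G.curvature (FiberBundle.extend (EuclideanSpace ℝ (Fin 4)) a)
    (FiberBundle.extend (EuclideanSpace ℝ (Fin 4)) b)
    (FiberBundle.extend (EuclideanSpace ℝ (Fin 4)) c) x

/-- The Ricci tensor `R_{αβ} = R_{αμβ}{}^μ`. -/
def ricci (x : M) (a b : TangentSpace (𝓡 4) x) : ℝ :=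
  ∑ i, eta i * G.g.val x (G.riemann x a (G.frame x i) b) (G.frame x i)

/-- The Ricci scalar `R = R_μ{}^μ`. -/
def scalar (x : M) : ℝ :=
  ∑ i, eta i * G.ricci x (G.frame x i) (G.frame x i)

section Congruence

variable (u : ∀ x : M, TangentSpace (𝓡 4) x)

/-- The projector `h_α{}^β = δ_α^β + u_α u^β` onto the orthogonal complement of `u`. -/
def proj (x : M) : TangentSpace (𝓡 4) x →L[ℝ] TangentSpace (𝓡 4) x :=
  ContinuousLinearMap.id ℝ (TangentSpace (𝓡 4) x) + (G.g.val x (u x)).smulRight (u x)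

/-- The tensor `h_{αβ} = g_{αβ} + u_α u_β`. -/
def h (x : M) (a b : TangentSpace (𝓡 4) x) : ℝ :=
  G.g.val x a b + G.g.val x (u x) a * G.g.val x (u x) b

/-- `B_β{}^α = ∇_β u^α + 2 S_{γβ}{}^α u^γ`, which governs the separation vector of the
congruence. -/
def sepTensor (x : M) : TangentSpace (𝓡 4) x →L[ℝ] TangentSpace (𝓡 4) x :=
  G.nabla u x + G.nabla.torsion x (u x)

/-- The orthogonal part `B_⊥{}_{αβ} = h_α{}^γ h_β{}^σ B_{γσ}`. -/
def sepPerp (x : M) (a b : TangentSpace (𝓡 4) x) : ℝ :=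
  G.g.val x (G.sepTensor u x (G.proj u x a)) (G.proj u x b)

/-- The expansion `θ = B_⊥{}_γ{}^γ`. -/
def expansion (x : M) : ℝ :=
  ∑ i, eta i * G.sepPerp u x (G.frame x i) (G.frame x i)

/-- The shear `σ_{αβ} = B_⊥{}_{(αβ)} - h_{αβ} θ / 3`. -/
def shear (x : M) (a b : TangentSpace (𝓡 4) x) : ℝ :=
  (G.sepPerp u x a b + G.sepPerp u x b a) / 2 - G.h u x a b * G.expansion u x / 3

/-- The vorticity `ω_{αβ} = B_⊥{}_{[αβ]}`. -/
def vorticity (x : M) (a b : TangentSpace (𝓡 4) x) : ℝ :=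
  (G.sepPerp u x a b - G.sepPerp u x b a) / 2

/-- The component `S_{αβ} = - h_α{}^μ h_β{}^ν u^σ S_{μνσ}` of the torsion. -/
def torsionTwo (x : M) (a b : TangentSpace (𝓡 4) x) : ℝ :=
  -G.g.val x (G.torsionTensor x (G.proj u x a) (G.proj u x b)) (u x)

/-- The projected Levi-Civita tensor `ε_{αβγ} = ε_{αβγσ} u^σ`. -/
def eps (x : M) (a b c : TangentSpace (𝓡 4) x) : ℝ := G.vol x ![a, b, c, u x]

/-- The torsion vector `S^γ = ½ ε^{γμν} S_{μν}`. -/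
def torsionVector (x : M) : TangentSpace (𝓡 4) x :=
  ∑ k, (eta k * ((1 / 2 : ℝ) * ∑ i, ∑ j, eta i * eta j *
    G.eps u x (G.frame x k) (G.frame x i) (G.frame x j) *
    G.torsionTwo u x (G.frame x i) (G.frame x j))) • G.frame x k

/-- The projected gradient `D_α f` of a function vanishes. -/
def NoSpatialGradient (f : M → ℝ) : Prop :=
  ∀ (x : M) (a : TangentSpace (𝓡 4) x), mfderiv (𝓡 4) 𝓘(ℝ) f x (G.proj u x a) = 0

end Congruence

end RiemannCartan

end Geometry

/-- A homogeneous cosmological model of the Einstein-Cartan theory whose source is a neutral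
Weyssenhoff fluid. -/
structure SpinningCosmology (M : Type v) [TopologicalSpace M]
    [ChartedSpace (EuclideanSpace ℝ (Fin 4)) M] [IsManifold (𝓡 4) ∞ M]
    extends RiemannCartan M where
  /-- the cosmological constant -/
  Λ : ℝ
  /-- the 4-velocity of the fluid -/
  u : ∀ x : M, TangentSpace (𝓡 4) x
  /-- the energy density -/
  μ : M → ℝ
  /-- the pressure -/
  p : M → ℝ
  /-- the heat flow -/
  q : ∀ x : M, TangentSpace (𝓡 4) x
  /-- the spin density tensor `Δ_{αβ}` -/
  spin : ∀ x : M, TangentSpace (𝓡 4) x →L[ℝ] TangentSpace (𝓡 4) x →L[ℝ] ℝ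
  u_smooth : ContMDiff (𝓡 4) (𝓡 4).tangent ∞ (fun x ↦ (u x : TangentBundle (𝓡 4) M))
  u_unit : ∀ x, g.val x (u x) (u x) = -1
  μ_smooth : ContMDiff (𝓡 4) 𝓘(ℝ) ∞ μ
  p_smooth : ContMDiff (𝓡 4) 𝓘(ℝ) ∞ p
  q_orthogonal : ∀ x, g.val x (q x) (u x) = 0
  spin_antisymm : ∀ x a b, spin x a b = -spin x b a
  spin_u : ∀ x a, spin x a (u x) = 0
  /-- `R_{αβ} - ½ g_{αβ} R + Λ g_{αβ} = 8π T_{αβ}` with the canonical stress-energy tensor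
  `T_{αβ} = μ u_α u_β + p h_{αβ} + q_α u_β` -/
  einstein : ∀ (x : M) (a b : TangentSpace (𝓡 4) x),
    toRiemannCartan.ricci x a b - (1 / 2) * g.val x a b * toRiemannCartan.scalar x
        + Λ * g.val x a b
      = 8 * Real.pi * (μ x * g.val x (u x) a * g.val x (u x) b
        + p x * toRiemannCartan.h u x a b + g.val x (q x) a * g.val x (u x) b)
  /-- `S_{αβγ} + 2 g_{γ[α} S_{β]μ}{}^μ = - 8π Δ_{αβγ}` with the intrinsic hypermomentum
  `Δ_{αβγ} = - Δ_{αβ} u_γ / (8π)` -/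
  cartan : ∀ (x : M) (a b c : TangentSpace (𝓡 4) x),
    g.val x (toRiemannCartan.torsionTensor x a b) c
        + (g.val x c a * toRiemannCartan.torsionTrace x b
          - g.val x c b * toRiemannCartan.torsionTrace x a)
      = -8 * Real.pi * (-(1 / (8 * Real.pi)) * spin x a b * g.val x (u x) c)
  shear_free : ∀ (x : M) (a b : TangentSpace (𝓡 4) x), toRiemannCartan.shear u x a b = 0
  expansion_homogeneous : toRiemannCartan.NoSpatialGradient u (toRiemannCartan.expansion u)
  μ_homogeneous : toRiemannCartan.NoSpatialGradient u μ
  p_homogeneous : toRiemannCartan.NoSpatialGradient u p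
  acceleration_free : ∀ x, nabla u x (u x) = 0
  vorticity_eq : ∀ (x : M) (a b : TangentSpace (𝓡 4) x),
    toRiemannCartan.vorticity u x a b = toRiemannCartan.torsionTwo u x a b

/-- `ι : V → M` exhibits the smooth 3-manifold without boundary `V` as a hypersurface of `M`
that is everywhere orthogonal to the congruence of `u`: a smooth injective map whose
differential at each point is an isomorphism onto the orthogonal complement of `u`. -/
structure IsOrthogonalSlice {M : Type v} [TopologicalSpace M]
    [ChartedSpace (EuclideanSpace ℝ (Fin 4)) M] [IsManifold (𝓡 4) ∞ M]
    (C : SpinningCosmology M)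
    {V : Type w} [TopologicalSpace V] [ChartedSpace (EuclideanSpace ℝ (Fin 3)) V]
    [IsManifold (𝓡 3) ∞ V] (ι : V → M) : Prop where
  smooth : ContMDiff (𝓡 3) (𝓡 4) ∞ ι
  injective : Function.Injective ι
  immersive : ∀ y : V, Function.Injective (mfderiv (𝓡 3) (𝓡 4) ι y)
  tangent : ∀ (y : V) (a : TangentSpace (𝓡 4) (ι y)),
    a ∈ Set.range (mfderiv (𝓡 3) (𝓡 4) ι y) ↔ C.g.val (ι y) a (C.u (ι y)) = 0

end

end EinsteinCartan

namespace EinsteinCartan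

noncomputable section

universe v w

/-! The 1-form metrically dual to the torsion vector is closed along the orthogonal complement of
`u`. On a simply connected orthogonal hypersurface it is therefore exact, and a primitive on a
compact hypersurface would have a maximum. The differential vanishes there, so the torsion vector is
orthogonal to the whole tangent space of the hypersurface. Being itself tangent to it
(`val_torsionVector_u`), it would be null, against the hypothesis.

Closedness comes from the field equations. Tracing the Cartan equation kills the torsion trace, so
the torsion is the spin density times `u` (`torsionTensor_eq`). With no shear and no acceleration,
and with vorticity equal to torsion, the covariant derivative of `u` is then one third of the
expansion times `h` plus the spin density (`val_nabla_u`). The Einstein equation gives zero for the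
Ricci tensor on `u` and a vector orthogonal to `u` (`ricci_u`). The first Bianchi identity rewrites
this component as a trace of the curvature acting on `u` (`val_curvature_eq`). Since the expansion
has no spatial gradient, what remains is the spatial divergence of the spin density
(`sum_div_spin`), which accordingly vanishes. The torsion vector is the spatial Hodge dual of the
spin density (`eps_mul_val_torsionVector`), so the divergence of one is the curl of the other
(`chartDeriv_torsionForm_comm`).

The passage to the hypersurface is de Rham theory in degree one: the pullback is closed
(`exists_hasFDerivAt_pullbackForm`), the Poincaré lemma on chart balls gives local primitives, and
these glue because a covering of a simply connected space has global sections
(`exists_hasMFDerivAt_of_locally`). -/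

lemma eta_mul_self (i : Fin 4) : eta i * eta i = 1 := by
  unfold eta; split_ifs <;> norm_num

/-! ### Orthonormal frames, and the pointwise content of the field equations -/

section LinearAlgebra

variable {M : Type v} [TopologicalSpace M]
  [ChartedSpace (EuclideanSpace ℝ (Fin 4)) M] [IsManifold (𝓡 4) ∞ M]

namespace LorentzMetric

variable (g : LorentzMetric M) {x : M}

/-- A basis of a tangent space which is orthonormal for the Lorentzian metric. -/
def IsOrthonormal (e : Module.Basis (Fin 4) ℝ (TangentSpace (𝓡 4) x)) : Prop :=
  ∀ i j, g.val x (e i) (e j) = if i = j then eta i else 0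

variable {g} {e f : Module.Basis (Fin 4) ℝ (TangentSpace (𝓡 4) x)}

lemma IsOrthonormal.val_left (he : g.IsOrthonormal e) (a : TangentSpace (𝓡 4) x) (i : Fin 4) :
    g.val x (e i) a = eta i * e.repr a i := by
  conv_lhs => rw [← e.sum_repr a]
  simp only [map_sum, map_smul, he i, smul_eq_mul, mul_ite, mul_zero, Finset.sum_ite_eq,
    Finset.mem_univ, if_true]
  ring

lemma IsOrthonormal.repr_eq (he : g.IsOrthonormal e) (a : TangentSpace (𝓡 4) x) (i : Fin 4) :
    e.repr a i = eta i * g.val x a (e i) := by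
  rw [g.symm, he.val_left, ← mul_assoc, eta_mul_self, one_mul]

lemma IsOrthonormal.sum_eq (he : g.IsOrthonormal e) (a : TangentSpace (𝓡 4) x) :
    ∑ i, (eta i * g.val x a (e i)) • e i = a := by
  simp_rw [← he.repr_eq]
  exact e.sum_repr a

lemma eq_of_val_eq {a b : TangentSpace (𝓡 4) x} (h : ∀ c, g.val x a c = g.val x b c) : a = b := by
  obtain ⟨e, he⟩ := g.exists_orthonormal x
  have he : g.IsOrthonormal e := he
  rw [← he.sum_eq a, ← he.sum_eq b]
  simp_rw [h]

/-- The metric trace of a bilinear form does not depend on the orthonormal basis. -/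
lemma IsOrthonormal.trace_eq (he : g.IsOrthonormal e) (hf : g.IsOrthonormal f)
    (B : TangentSpace (𝓡 4) x → TangentSpace (𝓡 4) x → ℝ)
    (hadd : ∀ a a' b, B (a + a') b = B a b + B a' b) (hsmul : ∀ (c : ℝ) a b, B (c • a) b = c * B a b)
    (hadd' : ∀ a b b', B a (b + b') = B a b + B a b')
    (hsmul' : ∀ (c : ℝ) a b, B a (c • b) = c * B a b) :
    ∑ i, eta i * B (e i) (e i) = ∑ i, eta i * B (f i) (f i) := by
  let B' : TangentSpace (𝓡 4) x →ₗ[ℝ] TangentSpace (𝓡 4) x →ₗ[ℝ] ℝ :=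
    LinearMap.mk₂ ℝ B hadd hsmul hadd' hsmul'
  have hB (a b) : B a b = B' a b := rfl
  simp_rw [hB]
  have key (i : Fin 4) : eta i * B' (e i) (e i) = ∑ j, ∑ k, eta j * eta k * B' (f j) (f k) *
      (eta i * g.val x (e i) (f j) * g.val x (e i) (f k)) := by
    conv_lhs => rw [← hf.sum_eq (e i)]
    simp only [map_sum, map_smul, LinearMap.sum_apply, LinearMap.smul_apply, smul_eq_mul,
      Finset.mul_sum]
    rw [Finset.sum_comm]
    refine Finset.sum_congr rfl fun j _ ↦ Finset.sum_congr rfl fun k _ ↦ ?_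
    ring
  have hg (j k : Fin 4) : ∑ i, eta i * g.val x (e i) (f j) * g.val x (e i) (f k)
      = if j = k then eta j else 0 := by
    rw [← hf j k]
    conv_rhs => rw [← he.sum_eq (f j)]
    simp only [map_sum, map_smul, sum_apply, smul_apply,
      smul_eq_mul]
    refine Finset.sum_congr rfl fun i _ ↦ ?_
    rw [g.symm x (e i) (f j)]
  simp_rw [key]
  rw [Finset.sum_comm]
  refine Finset.sum_congr rfl fun j _ ↦ ?_
  rw [Finset.sum_comm]
  simp_rw [← Finset.mul_sum, hg]
  simp only [mul_ite, mul_zero, Finset.sum_ite_eq, Finset.mem_univ, if_true]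
  linear_combination (eta j * B' (f j) (f j)) * eta_mul_self j

lemma exists_isOrthonormal_of_family (v : Fin 4 → TangentSpace (𝓡 4) x)
    (hv : ∀ i j, g.val x (v i) (v j) = if i = j then eta i else 0) :
    ∃ f : Module.Basis (Fin 4) ℝ (TangentSpace (𝓡 4) x), g.IsOrthonormal f ∧ ∀ i, f i = v i := by
  have hli : LinearIndependent ℝ v := by
    rw [Fintype.linearIndependent_iff]
    intro c hc i
    have := congrArg (g.val x (v i)) hc
    simp only [map_sum, map_smul, hv, smul_eq_mul, mul_ite, mul_zero, Finset.sum_ite_eq,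
      Finset.mem_univ, if_true, map_zero] at this
    have h2 := eta_mul_self i
    have : c i * (eta i * eta i) = 0 := by rw [← mul_assoc, this, zero_mul]
    simpa [h2] using this
  have hcard : Fintype.card (Fin 4) = Module.finrank ℝ (TangentSpace (𝓡 4) x) := by
    change _ = Module.finrank ℝ (EuclideanSpace ℝ (Fin 4))
    simp
  refine ⟨basisOfLinearIndependentOfCardEqFinrank hli hcard, ?_, ?_⟩
  · intro i j
    simpa using hv i j
  · simp

/-- Every unit timelike vector is the first vector of an orthonormal basis. -/
lemma exists_isOrthonormal_zero_eq (u : TangentSpace (𝓡 4) x) (hu : g.val x u u = -1) :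
    ∃ f : Module.Basis (Fin 4) ℝ (TangentSpace (𝓡 4) x), g.IsOrthonormal f ∧ f 0 = u := by
  obtain ⟨e, he⟩ := g.exists_orthonormal x
  -- Reflections in hyperplanes orthogonal to a non-null vector are isometries; one of them, up to
  -- sign, carries a given frame to one starting with `u`.
  have refl_isom (v : TangentSpace (𝓡 4) x) (hv : g.val x v v ≠ 0) (a b : TangentSpace (𝓡 4) x) :
      g.val x (a - (2 * g.val x a v / g.val x v v) • v)
        (b - (2 * g.val x b v / g.val x v v) • v) = g.val x a b := by
    simp only [map_sub, map_smul, sub_apply, smul_apply,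
      smul_eq_mul, g.symm x v b]
    field_simp
    ring
  have h00 : g.val x (e 0) (e 0) = -1 := by simp [he, eta]
  -- The reflection along `e 0 - u` sends `e 0` to `u`, but this vector is null exactly when the
  -- product is `-1`. In that case the reflection along `e 0 + u` sends `e 0` to `-u`, and its
  -- negative is used.
  by_cases h : g.val x (e 0) u = -1
  · set v := e 0 + u with hvdef
    have hv : g.val x v v = -4 := by
      simp only [hvdef, map_add, add_apply, h00, hu, h, g.symm x u (e 0)]
      norm_num
    have hv0 : g.val x (e 0) v = -2 := by
      simp only [hvdef, map_add, h00, h]; norm_num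
    obtain ⟨f, hf, hfv⟩ := exists_isOrthonormal_of_family (g := g)
      (fun i ↦ -(e i - (2 * g.val x (e i) v / g.val x v v) • v)) (by
        intro i j
        rw [map_neg, map_neg, neg_apply, neg_neg,
          refl_isom v (by rw [hv]; norm_num), he])
    refine ⟨f, hf, ?_⟩
    rw [hfv, hv0, hv, hvdef]
    norm_num
  · set v := e 0 - u with hvdef
    have hv : g.val x v v = -2 - 2 * g.val x (e 0) u := by
      simp only [hvdef, map_sub, sub_apply, h00, hu, g.symm x u (e 0)]
      ring
    have hvne : g.val x v v ≠ 0 := by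
      rw [hv]; intro h'; exact h (by linarith)
    have hv0 : g.val x (e 0) v = -1 - g.val x (e 0) u := by
      simp only [hvdef, map_sub, h00]
    obtain ⟨f, hf, hfv⟩ := exists_isOrthonormal_of_family (g := g)
      (fun i ↦ (e i - (2 * g.val x (e i) v / g.val x v v) • v)) (by
        intro i j
        rw [refl_isom v hvne, he])
    refine ⟨f, hf, ?_⟩
    have h1 : 2 * g.val x (e 0) v / g.val x v v = 1 := by
      rw [div_eq_one_iff_eq hvne, hv0, hv]; ring
    rw [hfv, h1, hvdef]
    simp

end LorentzMetric

namespace RiemannCartan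

variable (G : RiemannCartan M)

lemma frame_isOrthonormal (x : M) : G.g.IsOrthonormal (G.frame x) :=
  Classical.choose_spec (G.g.exists_orthonormal x)

lemma torsionTensor_apply (x : M) (a b : TangentSpace (𝓡 4) x) :
    G.torsionTensor x a b = (1 / 2 : ℝ) • G.nabla.torsion x a b := rfl

lemma torsionTrace_add (x : M) (a b : TangentSpace (𝓡 4) x) :
    G.torsionTrace x (a + b) = G.torsionTrace x a + G.torsionTrace x b := by
  simp only [torsionTrace, torsionTensor_apply, map_add, add_apply, smul_add,
    mul_add, Finset.sum_add_distrib]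

lemma torsionTrace_smul (x : M) (c : ℝ) (a : TangentSpace (𝓡 4) x) :
    G.torsionTrace x (c • a) = c * G.torsionTrace x a := by
  simp only [torsionTrace, torsionTensor_apply, map_smul, smul_apply,
    Finset.mul_sum, smul_eq_mul]
  refine Finset.sum_congr rfl fun i _ ↦ ?_
  ring

end RiemannCartan

namespace SpinningCosmology

variable (C : SpinningCosmology M) (x : M)

lemma spin_u_left (a : TangentSpace (𝓡 4) x) : C.spin x (C.u x) a = 0 := by
  rw [C.spin_antisymm, C.spin_u, neg_zero]

lemma spin_self (a : TangentSpace (𝓡 4) x) : C.spin x a a = 0 := by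
  have := C.spin_antisymm x a a
  linarith

lemma cartan_eq (a b c : TangentSpace (𝓡 4) x) :
    C.g.val x (C.torsionTensor x a b) c
        + (C.g.val x c a * C.torsionTrace x b - C.g.val x c b * C.torsionTrace x a)
      = C.spin x a b * C.g.val x (C.u x) c := by
  rw [C.cartan]
  have : Real.pi ≠ 0 := Real.pi_ne_zero
  field_simp

/-- Tracing the Cartan equation over its last two slots gives `(1 + 1 - 4)` times the torsion trace
on the left, and the spin density contracted with `u`, which is zero, on the right. -/
lemma torsionTrace_eq_zero (a : TangentSpace (𝓡 4) x) : C.torsionTrace x a = 0 := by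
  have he := C.toRiemannCartan.frame_isOrthonormal x
  set e := C.toRiemannCartan.frame x with hedef
  have h1 : ∑ i, eta i * (C.g.val x (C.torsionTensor x a (e i)) (e i)
        + (C.g.val x (e i) a * C.torsionTrace x (e i)
          - C.g.val x (e i) (e i) * C.torsionTrace x a))
      = ∑ i, eta i * (C.spin x a (e i) * C.g.val x (C.u x) (e i)) :=
    Finset.sum_congr rfl fun i _ ↦ by rw [C.cartan_eq]
  have h2 : ∑ i, eta i * (C.spin x a (e i) * C.g.val x (C.u x) (e i)) = 0 := by
    rw [← C.spin_u x a]
    conv_rhs => rw [← he.sum_eq (C.u x)]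
    simp only [map_sum, map_smul, smul_eq_mul]
    exact Finset.sum_congr rfl fun i _ ↦ by ring
  have h3 : ∑ i, eta i * (C.g.val x (e i) a * C.torsionTrace x (e i)) = C.torsionTrace x a := by
    let τ : TangentSpace (𝓡 4) x →ₗ[ℝ] ℝ :=
      { toFun := C.torsionTrace x
        map_add' := C.torsionTrace_add x
        map_smul' := C.torsionTrace_smul x }
    change _ = τ a
    conv_rhs => rw [← he.sum_eq a]
    simp only [map_sum, map_smul, smul_eq_mul]
    refine Finset.sum_congr rfl fun i _ ↦ ?_
    rw [C.g.symm x a (e i)]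
    change _ = _ * C.torsionTrace x (e i)
    ring
  have h4 : ∑ i, eta i * (C.g.val x (e i) (e i) * C.torsionTrace x a) = 4 * C.torsionTrace x a := by
    have : ∀ i, eta i * (C.g.val x (e i) (e i) * C.torsionTrace x a) = C.torsionTrace x a := by
      intro i
      rw [he i i, if_pos rfl, ← mul_assoc, eta_mul_self, one_mul]
    simp [this]
  have h5 : ∑ i, eta i * C.g.val x (C.torsionTensor x a (e i)) (e i) = C.torsionTrace x a := rfl
  simp only [mul_add, mul_sub, Finset.sum_add_distrib, Finset.sum_sub_distrib, h3, h4, h5] at h1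
  rw [h2] at h1
  linarith

lemma torsionTensor_eq (a b : TangentSpace (𝓡 4) x) :
    C.torsionTensor x a b = C.spin x a b • C.u x := by
  refine LorentzMetric.eq_of_val_eq (g := C.g) fun c ↦ ?_
  have := C.cartan_eq x a b c
  rw [C.torsionTrace_eq_zero, C.torsionTrace_eq_zero] at this
  simp only [map_smul, smul_apply, smul_eq_mul]
  linarith

lemma torsion_eq (a b : TangentSpace (𝓡 4) x) :
    C.nabla.torsion x a b = (2 * C.spin x a b) • C.u x := by
  have := C.torsionTensor_eq x a b
  rw [RiemannCartan.torsionTensor_apply] at this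
  rw [mul_smul, ← this, smul_smul]
  norm_num

lemma proj_apply (a : TangentSpace (𝓡 4) x) :
    C.proj C.u x a = a + C.g.val x (C.u x) a • C.u x := by
  simp [RiemannCartan.proj]

lemma torsionTwo_eq (a b : TangentSpace (𝓡 4) x) : C.torsionTwo C.u x a b = C.spin x a b := by
  rw [RiemannCartan.torsionTwo, C.torsionTensor_eq]
  simp [proj_apply, C.spin_u, C.spin_u_left, C.u_unit]

lemma mdifferentiableAt_u :
    MDifferentiableAt (𝓡 4) (𝓡 4).tangent (fun y ↦ (C.u y : TangentBundle (𝓡 4) M)) x :=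
  C.u_smooth.mdifferentiable (by simp) x

lemma val_nabla_u_u (a : TangentSpace (𝓡 4) x) :
    C.g.val x (C.nabla C.u x a) (C.u x) = 0 := by
  have h := C.nabla_metric C.u C.u x (C.mdifferentiableAt_u x) (C.mdifferentiableAt_u x) a
  have hc : (fun y ↦ C.g.val y (C.u y) (C.u y)) = fun _ ↦ (-1 : ℝ) := funext C.u_unit
  rw [hc, mfderiv_const] at h
  rw [C.g.symm x (C.u x) (C.nabla C.u x a)] at h
  have h0 : (0 : ℝ) = _ := h
  linarith

/-- The torsion term of `sepTensor` drops out since the spin density annihilates `u`, and the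
projections act trivially since `u` is geodesic and of unit length. So the derivative of `u` is the
sum of its expansion, shear and vorticity parts, with zero shear and vorticity equal to the spin
density. -/
lemma val_nabla_u (a b : TangentSpace (𝓡 4) x) :
    C.g.val x (C.nabla C.u x a) b
      = C.expansion C.u x / 3 * C.h C.u x a b + C.spin x a b := by
  have hsep (a b : TangentSpace (𝓡 4) x) :
      C.sepPerp C.u x a b = C.g.val x (C.nabla C.u x a) b := by
    simp [RiemannCartan.sepPerp, RiemannCartan.sepTensor, C.torsion_eq, C.spin_u_left, proj_apply,
      C.acceleration_free, C.val_nabla_u_u]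
  have h1 := C.shear_free x a b
  have h2 := C.vorticity_eq x a b
  rw [C.torsionTwo_eq] at h2
  rw [RiemannCartan.shear] at h1
  rw [RiemannCartan.vorticity] at h2
  rw [hsep, hsep] at h1 h2
  linarith

/-- The order of the slots matters: the heat flow enters the stress-energy tensor through its first
slot, where `u` annihilates it. -/
lemma ricci_u (b : TangentSpace (𝓡 4) x) (hb : C.g.val x (C.u x) b = 0) :
    C.ricci x (C.u x) b = 0 := by
  have := C.einstein x (C.u x) b
  simp only [RiemannCartan.h, hb, C.q_orthogonal] at this
  linarith

end SpinningCosmology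

end LinearAlgebra

/-! ### The projected volume form and the torsion vector as a Hodge dual -/

section LinearAlgebra

variable {M : Type v} [TopologicalSpace M]
  [ChartedSpace (EuclideanSpace ℝ (Fin 4)) M] [IsManifold (𝓡 4) ∞ M]

namespace RiemannCartan

variable (G : RiemannCartan M) (u : ∀ x : M, TangentSpace (𝓡 4) x) (x : M)

lemma eps_add_left (a a' b c : TangentSpace (𝓡 4) x) :
    G.eps u x (a + a') b c = G.eps u x a b c + G.eps u x a' b c :=
  (G.vol x).map_vecCons_add ![b, c, u x] a a'

lemma eps_smul_left (r : ℝ) (a b c : TangentSpace (𝓡 4) x) :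
    G.eps u x (r • a) b c = r * G.eps u x a b c :=
  (G.vol x).map_vecCons_smul ![b, c, u x] r a

lemma eps_swap_left (a b c : TangentSpace (𝓡 4) x) : G.eps u x b a c = -G.eps u x a b c := by
  have h := (G.vol x).map_swap ![a, b, c, u x] (i := 0) (j := 1) (by decide)
  rw [eps, eps, ← h]
  congr 1
  ext i
  fin_cases i <;> rfl

lemma eps_swap_right (a b c : TangentSpace (𝓡 4) x) : G.eps u x a c b = -G.eps u x a b c := by
  have h := (G.vol x).map_swap ![a, b, c, u x] (i := 1) (j := 2) (by decide)
  rw [eps, eps, ← h]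
  congr 1
  ext i
  fin_cases i <;> rfl

lemma eps_self_left (b c : TangentSpace (𝓡 4) x) : G.eps u x (u x) b c = 0 :=
  (G.vol x).map_eq_zero_of_eq ![u x, b, c, u x] (i := 0) (j := 3) rfl (by decide)

lemma eps_self_middle (a c : TangentSpace (𝓡 4) x) : G.eps u x a (u x) c = 0 := by
  rw [eps_swap_left, eps_self_left, neg_zero]

lemma eps_self_right (a b : TangentSpace (𝓡 4) x) : G.eps u x a b (u x) = 0 := by
  rw [eps_swap_right, eps_self_middle, neg_zero]

lemma eps_eq_zero_left (a c : TangentSpace (𝓡 4) x) : G.eps u x a a c = 0 := by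
  have := G.eps_swap_left u x a a c
  linarith

lemma eps_eq_zero_right (a c : TangentSpace (𝓡 4) x) : G.eps u x a c c = 0 := by
  have := G.eps_swap_right u x a c c
  linarith

lemma eps_add_middle (a b b' c : TangentSpace (𝓡 4) x) :
    G.eps u x a (b + b') c = G.eps u x a b c + G.eps u x a b' c := by
  rw [eps_swap_left, eps_add_left, eps_swap_left _ _ _ a b, eps_swap_left _ _ _ a b']
  ring

lemma eps_smul_middle (r : ℝ) (a b c : TangentSpace (𝓡 4) x) :
    G.eps u x a (r • b) c = r * G.eps u x a b c := by
  rw [eps_swap_left, eps_smul_left, eps_swap_left _ _ _ a b]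
  ring

lemma eps_add_right (a b c c' : TangentSpace (𝓡 4) x) :
    G.eps u x a b (c + c') = G.eps u x a b c + G.eps u x a b c' := by
  rw [eps_swap_right, eps_add_middle, eps_swap_right _ _ _ a b, eps_swap_right _ _ _ a b]
  ring

lemma eps_smul_right (r : ℝ) (a b c : TangentSpace (𝓡 4) x) :
    G.eps u x a b (r • c) = r * G.eps u x a b c := by
  rw [eps_swap_right, eps_smul_middle, eps_swap_right _ _ _ a b]
  ring

/-- The square of the projected volume form is the Gram determinant of `h`. -/
lemma eps_sq (hu : G.g.val x (u x) (u x) = -1) (a b c : TangentSpace (𝓡 4) x) :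
    G.eps u x a b c ^ 2
      = G.h u x a a * (G.h u x b b * G.h u x c c - G.h u x b c ^ 2)
        - G.h u x a b * (G.h u x a b * G.h u x c c - G.h u x a c * G.h u x b c)
        + G.h u x a c * (G.h u x a b * G.h u x b c - G.h u x a c * G.h u x b b) := by
  rw [eps, G.vol_sq]
  simp only [h, Matrix.det_succ_row_zero, Fin.sum_univ_succ, Matrix.of_apply, Matrix.submatrix,
    Matrix.det_unique, Fin.succAbove, Fin.default_eq_zero]
  simp [Fin.lt_def, Fin.succ, hu, G.g.symm x (u x), G.g.symm x b a, G.g.symm x c a,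
    G.g.symm x c b]
  ring

end RiemannCartan

namespace SpinningCosmology

variable (C : SpinningCosmology M) (x : M)

/-- The component of the torsion vector along `c`, in any orthonormal frame. -/
lemma val_torsionVector (c : TangentSpace (𝓡 4) x)
    {f : Module.Basis (Fin 4) ℝ (TangentSpace (𝓡 4) x)} (hf : C.g.IsOrthonormal f) :
    C.g.val x (C.torsionVector C.u x) c
      = 1 / 2 * ∑ i, eta i * ∑ j, eta j * (C.eps C.u x c (f i) (f j) * C.spin x (f i) (f j)) := by
  have he := C.toRiemannCartan.frame_isOrthonormal x
  set e := C.toRiemannCartan.frame x with hedef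
  have h1 : C.g.val x (C.torsionVector C.u x) c
      = 1 / 2 * ∑ i, eta i * ∑ j, eta j * (C.eps C.u x c (e i) (e j) * C.spin x (e i) (e j)) := by
    let L : TangentSpace (𝓡 4) x →ₗ[ℝ] ℝ :=
      { toFun := fun c ↦ 1 / 2 * ∑ i, eta i *
          ∑ j, eta j * (C.eps C.u x c (e i) (e j) * C.spin x (e i) (e j))
        map_add' := fun a b ↦ by
          simp only [RiemannCartan.eps_add_left, add_mul, mul_add, Finset.sum_add_distrib]
        map_smul' := fun r a ↦ by
          simp only [RiemannCartan.eps_smul_left, smul_eq_mul, RingHom.id_apply, Finset.mul_sum]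
          exact Finset.sum_congr rfl fun i _ ↦ Finset.sum_congr rfl fun j _ ↦ by ring }
    change _ = L c
    conv_rhs => rw [← he.sum_eq c]
    simp only [RiemannCartan.torsionVector, map_sum, map_smul, sum_apply, smul_apply, smul_eq_mul,
      ← hedef]
    refine Finset.sum_congr rfl fun k _ ↦ ?_
    change _ = _ * (1 / 2 * ∑ i, eta i *
          ∑ j, eta j * (C.eps C.u x (e k) (e i) (e j) * C.spin x (e i) (e j)))
    rw [C.g.symm x (e k) c]
    have : ∑ i, ∑ j, eta i * eta j * C.eps C.u x (e k) (e i) (e j) * C.torsionTwo C.u x (e i) (e j)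
      = ∑ i, eta i *
          ∑ j, eta j * (C.eps C.u x (e k) (e i) (e j) * C.spin x (e i) (e j)) := by
      simp only [C.torsionTwo_eq, Finset.mul_sum]
      exact Finset.sum_congr rfl fun i _ ↦ Finset.sum_congr rfl fun j _ ↦ by ring
    rw [this]
    ring
  rw [h1]
  congr 1
  have h2 (i : Fin 4) :
      ∑ j, eta j * (C.eps C.u x c (e i) (e j) * C.spin x (e i) (e j))
        = ∑ j, eta j * (C.eps C.u x c (e i) (f j) * C.spin x (e i) (f j)) := by
    have h3 := he.trace_eq hf
      (fun a b ↦ C.eps C.u x c (e i) a * C.spin x (e i) b)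
      (fun _ _ _ ↦ by simp only [RiemannCartan.eps_add_right]; ring)
      (fun _ _ _ ↦ by simp only [RiemannCartan.eps_smul_right]; ring)
      (fun _ _ _ ↦ by simp only [map_add]; ring)
      (fun _ _ _ ↦ by simp only [map_smul, smul_eq_mul]; ring)
    exact h3
  simp only [h2]
  refine he.trace_eq hf
      (fun a b ↦ ∑ j, eta j * (C.eps C.u x c a (f j) * C.spin x b (f j)))
      (fun _ _ _ ↦ ?_) (fun _ _ _ ↦ ?_) (fun _ _ _ ↦ ?_) (fun _ _ _ ↦ ?_)
  · simp only [RiemannCartan.eps_add_middle, add_mul, mul_add, Finset.sum_add_distrib]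
  · simp only [RiemannCartan.eps_smul_middle, Finset.mul_sum]
    exact Finset.sum_congr rfl fun i _ ↦ by ring
  · simp only [map_add, add_apply, mul_add, Finset.sum_add_distrib]
  · simp only [map_smul, smul_apply, smul_eq_mul, Finset.mul_sum]
    exact Finset.sum_congr rfl fun i _ ↦ by ring

lemma val_torsionVector_u : C.g.val x (C.torsionVector C.u x) (C.u x) = 0 := by
  rw [C.val_torsionVector x _ (C.toRiemannCartan.frame_isOrthonormal x)]
  simp [RiemannCartan.eps_self_left]

/-- The torsion vector is the spatial Hodge dual of the spin density. -/
lemma eps_mul_val_torsionVector (a b d c : TangentSpace (𝓡 4) x) :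
    C.eps C.u x a b d * C.g.val x (C.torsionVector C.u x) c
      = C.spin x b d * C.h C.u x a c + C.spin x d a * C.h C.u x b c
        + C.spin x a b * C.h C.u x d c := by
  obtain ⟨f, hf, hf0⟩ := LorentzMetric.exists_isOrthonormal_zero_eq (g := C.g) (C.u x) (C.u_unit x)
  -- The sign of the volume form on the frame depends on the orientation. Only its square enters,
  -- because the torsion vector already contains one factor of the volume form.
  have hκ : C.eps C.u x (f 1) (f 2) (f 3) ^ 2 = 1 := by
    rw [RiemannCartan.eps_sq _ _ _ (C.u_unit x)]
    simp [RiemannCartan.h, ← hf0, hf _ _, eta]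
  set κ := C.eps C.u x (f 1) (f 2) (f 3) with hκdef
  have e213 : C.eps C.u x (f 2) (f 1) (f 3) = -κ := RiemannCartan.eps_swap_left ..
  have e132 : C.eps C.u x (f 1) (f 3) (f 2) = -κ := RiemannCartan.eps_swap_right ..
  have e231 : C.eps C.u x (f 2) (f 3) (f 1) = κ := by
    rw [RiemannCartan.eps_swap_right, e213, neg_neg]
  have e312 : C.eps C.u x (f 3) (f 1) (f 2) = κ := by
    rw [RiemannCartan.eps_swap_left, e132, neg_neg]
  have e321 : C.eps C.u x (f 3) (f 2) (f 1) = -κ := by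
    rw [RiemannCartan.eps_swap_left, e231]
  have expand (v : TangentSpace (𝓡 4) x) : v = f.repr v 0 • C.u x + f.repr v 1 • f 1
      + f.repr v 2 • f 2 + f.repr v 3 • f 3 := by
    conv_lhs => rw [← f.sum_repr v]
    rw [Fin.sum_univ_four, hf0]
  have hS : ∀ v, C.g.val x (C.torsionVector C.u x) v = κ * (f.repr v 1 * C.spin x (f 2) (f 3)
      + f.repr v 2 * C.spin x (f 3) (f 1) + f.repr v 3 * C.spin x (f 1) (f 2)) := by
    intro v
    rw [C.val_torsionVector x v hf]
    have s21 := C.spin_antisymm x (f 2) (f 1)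
    have s32 := C.spin_antisymm x (f 3) (f 2)
    have s13 := C.spin_antisymm x (f 1) (f 3)
    conv_lhs => rw [expand v]
    generalize f.repr v 0 = v0
    generalize f.repr v 1 = v1
    generalize f.repr v 2 = v2
    generalize f.repr v 3 = v3
    simp only [Fin.sum_univ_four, hf0, RiemannCartan.eps_add_left, RiemannCartan.eps_smul_left,
      RiemannCartan.eps_self_left, RiemannCartan.eps_self_middle, RiemannCartan.eps_self_right,
      RiemannCartan.eps_eq_zero_left, RiemannCartan.eps_eq_zero_right, C.spin_self, C.spin_u,
      C.spin_u_left, e213, e132, e231, e312, e321, ← hκdef, s21, s32, s13, eta]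
    have eaba : ∀ p q : TangentSpace (𝓡 4) x, C.eps C.u x p q p = 0 := fun p q ↦ by
      rw [RiemannCartan.eps_swap_right, RiemannCartan.eps_eq_zero_left, neg_zero]
    simp [eaba]
    ring
  have hh : ∀ v z, C.h C.u x v z = f.repr v 1 * f.repr z 1 + f.repr v 2 * f.repr z 2
      + f.repr v 3 * f.repr z 3 := by
    intro v z
    simp only [RiemannCartan.h, hf.repr_eq]
    conv_lhs => rw [← hf.sum_eq v]
    simp only [Fin.sum_univ_four, map_add, map_smul, add_apply, smul_apply, smul_eq_mul, hf0,
      C.g.symm x (f _) z]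
    rw [← hf0]
    simp [hf _ _, eta, C.g.symm x (f 0) z]
    ring
  have hspin : ∀ v z, C.spin x v z =
      (f.repr v 1 * f.repr z 2 - f.repr v 2 * f.repr z 1) * C.spin x (f 1) (f 2)
      + (f.repr v 2 * f.repr z 3 - f.repr v 3 * f.repr z 2) * C.spin x (f 2) (f 3)
      + (f.repr v 3 * f.repr z 1 - f.repr v 1 * f.repr z 3) * C.spin x (f 3) (f 1) := by
    intro v z
    have s21 := C.spin_antisymm x (f 2) (f 1)
    have s32 := C.spin_antisymm x (f 3) (f 2)
    have s13 := C.spin_antisymm x (f 1) (f 3)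
    conv_lhs => rw [expand v, expand z]
    simp only [map_add, map_smul, add_apply, smul_apply, smul_eq_mul, C.spin_u, C.spin_u_left,
      C.spin_self, s21, s32, s13]
    ring
  have heps : C.eps C.u x a b d = κ * (
      f.repr a 1 * (f.repr b 2 * f.repr d 3 - f.repr b 3 * f.repr d 2)
      - f.repr a 2 * (f.repr b 1 * f.repr d 3 - f.repr b 3 * f.repr d 1)
      + f.repr a 3 * (f.repr b 1 * f.repr d 2 - f.repr b 2 * f.repr d 1)) := by
    have eaba : ∀ p q : TangentSpace (𝓡 4) x, C.eps C.u x p q p = 0 := fun p q ↦ by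
      rw [RiemannCartan.eps_swap_right, RiemannCartan.eps_eq_zero_left, neg_zero]
    conv_lhs => rw [expand a, expand b, expand d]
    simp only [RiemannCartan.eps_add_left, RiemannCartan.eps_smul_left,
      RiemannCartan.eps_add_middle, RiemannCartan.eps_smul_middle,
      RiemannCartan.eps_add_right, RiemannCartan.eps_smul_right,
      RiemannCartan.eps_self_left, RiemannCartan.eps_self_middle, RiemannCartan.eps_self_right,
      RiemannCartan.eps_eq_zero_left, RiemannCartan.eps_eq_zero_right, eaba,
      e213, e132, e231, e312, e321, ← hκdef]
    ring
  rw [heps, hS, hh, hh, hh, hspin b d, hspin d a, hspin a b]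
  generalize C.spin x (f 1) (f 2) = s12
  generalize C.spin x (f 2) (f 3) = s23
  generalize C.spin x (f 3) (f 1) = s31
  linear_combination (
      f.repr a 1 * (f.repr b 2 * f.repr d 3 - f.repr b 3 * f.repr d 2)
      - f.repr a 2 * (f.repr b 1 * f.repr d 3 - f.repr b 3 * f.repr d 1)
      + f.repr a 3 * (f.repr b 1 * f.repr d 2 - f.repr b 2 * f.repr d 1)) *
      (f.repr c 1 * s23 + f.repr c 2 * s31 + f.repr c 3 * s12) * hκ

end SpinningCosmology

end LinearAlgebra

/-! ### Coordinate vector fields of a chart -/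

section CoordinateFields

variable {n : ℕ} {M : Type v} [TopologicalSpace M]
  [ChartedSpace (EuclideanSpace ℝ (Fin n)) M] [IsManifold (𝓡 n) ∞ M] {x y : M}

/-- The vector field with constant components `a` in the preferred chart at `x`. -/
abbrev coordField {x : M} (a : TangentSpace (𝓡 n) x) (y : M) : TangentSpace (𝓡 n) y :=
  FiberBundle.extend (EuclideanSpace ℝ (Fin n)) a y

lemma coordField_self (a : TangentSpace (𝓡 n) x) : coordField a x = a :=
  FiberBundle.extend_apply_self _ a

lemma coordField_eq_symmL (a : TangentSpace (𝓡 n) x)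
    (hy : y ∈ (chartAt (EuclideanSpace ℝ (Fin n)) x).source) :
    coordField a y
      = (trivializationAt (EuclideanSpace ℝ (Fin n)) (TangentSpace (𝓡 n)) x).symmL ℝ y a := by
  -- The preferred trivialization at `x` is the identity on the fibre over `x` itself.
  have h1 : (trivializationAt (EuclideanSpace ℝ (Fin n)) (TangentSpace (𝓡 n)) x ⟨x, a⟩).2 = a := by
    have h2 := TangentBundle.continuousLinearMapAt_trivializationAt (I := 𝓡 n) (x₀ := x) (x := x)
      (mem_chart_source _ x)
    rw [mfderiv_extChartAt_self] at h2
    have h3 := congrArg (fun L ↦ L a) h2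
    rw [Bundle.Trivialization.continuousLinearMapAt_apply,
      Bundle.Trivialization.linearMapAt_apply, if_pos (by simp)] at h3
    exact h3
  rw [coordField, FiberBundle.extend, h1]
  exact (Bundle.Trivialization.symmL_apply (R := ℝ)
    (trivializationAt (EuclideanSpace ℝ (Fin n)) (TangentSpace (𝓡 n)) x) (by simpa using hy)
    (show EuclideanSpace ℝ (Fin n) from a)).symm

lemma coordField_eq_mfderiv (a : TangentSpace (𝓡 n) x)
    (hy : y ∈ (chartAt (EuclideanSpace ℝ (Fin n)) x).source) :
    coordField a y = mfderiv 𝓘(ℝ, EuclideanSpace ℝ (Fin n)) (𝓡 n) (extChartAt (𝓡 n) x).symm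
      (extChartAt (𝓡 n) x y) a := by
  rw [coordField_eq_symmL a hy, TangentBundle.symmL_trivializationAt hy]
  simp only [ModelWithCorners.range_eq_univ, mfderivWithin_univ]
  rfl

lemma coordField_add (a b : TangentSpace (𝓡 n) x)
    (hy : y ∈ (chartAt (EuclideanSpace ℝ (Fin n)) x).source) :
    coordField (a + b) y = coordField a y + coordField b y := by
  rw [coordField_eq_symmL _ hy, coordField_eq_symmL _ hy, coordField_eq_symmL _ hy]
  exact map_add _ _ _

lemma coordField_smul (c : ℝ) (a : TangentSpace (𝓡 n) x)
    (hy : y ∈ (chartAt (EuclideanSpace ℝ (Fin n)) x).source) :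
    coordField (c • a) y = c • coordField a y := by
  rw [coordField_eq_symmL _ hy, coordField_eq_symmL _ hy]
  exact map_smul _ _ _

lemma contMDiffAt_coordField (a : TangentSpace (𝓡 n) x)
    (hy : y ∈ (chartAt (EuclideanSpace ℝ (Fin n)) x).source) :
    ContMDiffAt (𝓡 n) (𝓡 n).tangent ∞ (fun z ↦ (coordField a z : TangentBundle (𝓡 n) M)) y := by
  set t := trivializationAt (EuclideanSpace ℝ (Fin n)) (TangentSpace (𝓡 n)) x
  have hyt : y ∈ t.baseSet := by simpa [t] using hy
  refine (t.contMDiffAt_section_iff (IB := 𝓡 n) hyt).2 ?_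
  refine (contMDiffAt_const (c := (t ⟨x, a⟩).2)).congr_of_eventuallyEq ?_
  filter_upwards [t.open_baseSet.mem_nhds hyt] with z hz
  change (t ⟨z, t.symm z (t ⟨x, a⟩).2⟩).2 = _
  rw [t.apply_mk_symm hz]

lemma mdifferentiableAt_extChartAt_symm' {z : EuclideanSpace ℝ (Fin n)}
    (hz : z ∈ (extChartAt (𝓡 n) x).target) :
    MDifferentiableAt 𝓘(ℝ, EuclideanSpace ℝ (Fin n)) (𝓡 n) (extChartAt (𝓡 n) x).symm z := by
  have := mdifferentiableWithinAt_extChartAt_symm (I := 𝓡 n) hz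
  simpa [mdifferentiableWithinAt_univ] using this

/-- Coordinate fields act on functions as partial derivatives in the chart. -/
lemma mfderiv_coordField {f : M → ℝ} (a : TangentSpace (𝓡 n) x)
    (hy : y ∈ (chartAt (EuclideanSpace ℝ (Fin n)) x).source)
    (hf : MDifferentiableAt (𝓡 n) 𝓘(ℝ) f y) :
    mfderiv (𝓡 n) 𝓘(ℝ) f y (coordField a y)
      = fderiv ℝ (f ∘ (extChartAt (𝓡 n) x).symm) (extChartAt (𝓡 n) x y) a := by
  have hy' : y ∈ (extChartAt (𝓡 n) x).source := by simpa using hy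
  have hφy : (extChartAt (𝓡 n) x).symm (extChartAt (𝓡 n) x y) = y :=
    (extChartAt (𝓡 n) x).left_inv hy'
  rw [coordField_eq_mfderiv a hy, ← mfderiv_eq_fderiv, mfderiv_comp_of_eq (y := y) hf
    (mdifferentiableAt_extChartAt_symm' ((extChartAt (𝓡 n) x).map_source hy')) hφy]
  change _ = mfderiv (𝓡 n) 𝓘(ℝ) f ((extChartAt (𝓡 n) x).symm (extChartAt (𝓡 n) x y))
    (mfderiv 𝓘(ℝ, EuclideanSpace ℝ (Fin n)) (𝓡 n) (extChartAt (𝓡 n) x).symm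
      (extChartAt (𝓡 n) x y) a)
  rw [hφy]

/-- Coordinate fields are pullbacks under the chart of constant fields on the model space, which
commute, and pullback respects brackets. -/
lemma mlieBracket_coordField (a b : TangentSpace (𝓡 n) x)
    (hy : y ∈ (chartAt (EuclideanSpace ℝ (Fin n)) x).source) :
    VectorField.mlieBracket (𝓡 n) (coordField a) (coordField b) y = 0 := by
  let K (a : TangentSpace (𝓡 n) x) : ∀ z : EuclideanSpace ℝ (Fin n),
    TangentSpace 𝓘(ℝ, EuclideanSpace ℝ (Fin n)) z := fun _ ↦ a
  have hK (a : TangentSpace (𝓡 n) x) : coordField a =ᶠ[nhds y] VectorField.mpullback (𝓡 n)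
      𝓘(ℝ, EuclideanSpace ℝ (Fin n)) (extChartAt (𝓡 n) x) (K a) := by
    filter_upwards [(chartAt (EuclideanSpace ℝ (Fin n)) x).open_source.mem_nhds hy] with z hz
    rw [VectorField.mpullback_apply]
    refine ((isInvertible_mfderiv_extChartAt (by simpa using hz)).inverse_apply_eq.2 ?_).symm
    rw [coordField_eq_symmL a hz, ← TangentBundle.continuousLinearMapAt_trivializationAt hz]
    exact (Bundle.Trivialization.continuousLinearMapAt_symmL (R := ℝ)
      (trivializationAt (EuclideanSpace ℝ (Fin n)) (TangentSpace (𝓡 n)) x) (by simpa using hz)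
      (show EuclideanSpace ℝ (Fin n) from a)).symm
  have hKd (a : TangentSpace (𝓡 n) x) (z : EuclideanSpace ℝ (Fin n)) :
      MDifferentiableAt 𝓘(ℝ, EuclideanSpace ℝ (Fin n)) (𝓘(ℝ, EuclideanSpace ℝ (Fin n))).tangent
        (fun z ↦ (⟨z, K a z⟩ : TangentBundle 𝓘(ℝ, EuclideanSpace ℝ (Fin n))
          (EuclideanSpace ℝ (Fin n)))) z :=
    (contMDiffAt_vectorSpace_iff_contDiffAt.2 contDiffAt_const).mdifferentiableAt one_ne_zero
  have : IsManifold (𝓡 n) (minSmoothness ℝ 2) M := by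
    rw [minSmoothness_of_isRCLikeNormedField]; infer_instance
  rw [(hK a).mlieBracket_vectorField_eq (hK b),
    ← VectorField.mpullback_mlieBracket (n := 2) (hKd a _) (hKd b _)
      (contMDiffAt_extChartAt' hy)
      minSmoothness_of_isRCLikeNormedField.le]
  have h0 : VectorField.mlieBracket 𝓘(ℝ, EuclideanSpace ℝ (Fin n)) (K a) (K b) = 0 := by
    ext1 z
    have h1 (p q : EuclideanSpace ℝ (Fin n)) :
        VectorField.lieBracketWithin ℝ (fun _ ↦ p) (fun _ ↦ q) Set.univ z = 0 := by
      simp [VectorField.lieBracketWithin_univ, VectorField.lieBracket_eq]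
    rw [← VectorField.mlieBracketWithin_univ]
    exact (congrFun VectorField.mlieBracketWithin_eq_lieBracketWithin z).trans (h1 _ _)
  rw [h0, VectorField.mpullback_zero]
  rfl

/-- A vector field that is smooth near a point agrees near that point with a global smooth vector
field. -/
lemma exists_contMDiff_eventuallyEq [T2Space M] {σ : ∀ z : M, TangentSpace (𝓡 n) z} {s : Set M}
    (hs : IsOpen s) (hx : x ∈ s)
    (hσ : ContMDiffOn (𝓡 n) (𝓡 n).tangent ∞ (fun z ↦ (σ z : TangentBundle (𝓡 n) M)) s) :
    ∃ σ' : ∀ z : M, TangentSpace (𝓡 n) z,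
      ContMDiff (𝓡 n) (𝓡 n).tangent ∞ (fun z ↦ (σ' z : TangentBundle (𝓡 n) M)) ∧
      ∀ᶠ z in nhds x, σ' z = σ z := by
  obtain ⟨f, -, hf⟩ := (SmoothBumpFunction.nhds_basis_tsupport (I := 𝓡 n) x).mem_iff.1
    (hs.mem_nhds hx)
  refine ⟨(f : M → ℝ) • σ, ?_, ?_⟩
  · exact ContMDiffOn.smul_section_of_tsupport f.contMDiff.contMDiffOn hs hf hσ
  · filter_upwards [f.eventuallyEq_one] with z hz
    simp [hz]

end CoordinateFields

/-! ### Smooth fields and functions on a chart, and their coordinate derivatives -/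

section ChartDerivative

variable {M : Type v} [TopologicalSpace M]
  [ChartedSpace (EuclideanSpace ℝ (Fin 4)) M] [IsManifold (𝓡 4) ∞ M] {x y : M}

/-- The vector field `Y` is smooth on the domain of the preferred chart at `x`. -/
def SmoothField (x : M) (Y : ∀ y : M, TangentSpace (𝓡 4) y) : Prop :=
  ContMDiffOn (𝓡 4) (𝓡 4).tangent ∞ (fun y ↦ (Y y : TangentBundle (𝓡 4) M))
    (chartAt (EuclideanSpace ℝ (Fin 4)) x).source

/-- The function `F` is smooth on the domain of the preferred chart at `x`. -/
def SmoothFn (x : M) (F : M → ℝ) : Prop :=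
  ContMDiffOn (𝓡 4) 𝓘(ℝ) ∞ F (chartAt (EuclideanSpace ℝ (Fin 4)) x).source

set_option linter.unusedSectionVars false

/-- The derivative at `x` of a function, in the preferred chart at `x`. -/
def chartDeriv (x : M) (F : M → ℝ) : EuclideanSpace ℝ (Fin 4) →L[ℝ] ℝ :=
  fderiv ℝ (F ∘ (extChartAt (𝓡 4) x).symm) (extChartAt (𝓡 4) x x)

lemma SmoothField.contMDiffAt {Y : ∀ y : M, TangentSpace (𝓡 4) y} (hY : SmoothField x Y)
    (hy : y ∈ (chartAt (EuclideanSpace ℝ (Fin 4)) x).source) :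
    ContMDiffAt (𝓡 4) (𝓡 4).tangent ∞ (fun y ↦ (Y y : TangentBundle (𝓡 4) M)) y :=
  ContMDiffOn.contMDiffAt hY ((chartAt (EuclideanSpace ℝ (Fin 4)) x).open_source.mem_nhds hy)

lemma SmoothField.mdifferentiableAt {Y : ∀ y : M, TangentSpace (𝓡 4) y} (hY : SmoothField x Y)
    (hy : y ∈ (chartAt (EuclideanSpace ℝ (Fin 4)) x).source) :
    MDifferentiableAt (𝓡 4) (𝓡 4).tangent (fun y ↦ (Y y : TangentBundle (𝓡 4) M)) y :=
  (hY.contMDiffAt hy).mdifferentiableAt (by simp)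

lemma SmoothFn.contMDiffAt {F : M → ℝ} (hF : SmoothFn x F)
    (hy : y ∈ (chartAt (EuclideanSpace ℝ (Fin 4)) x).source) :
    ContMDiffAt (𝓡 4) 𝓘(ℝ) ∞ F y :=
  ContMDiffOn.contMDiffAt hF ((chartAt (EuclideanSpace ℝ (Fin 4)) x).open_source.mem_nhds hy)

lemma SmoothFn.mdifferentiableAt {F : M → ℝ} (hF : SmoothFn x F)
    (hy : y ∈ (chartAt (EuclideanSpace ℝ (Fin 4)) x).source) :
    MDifferentiableAt (𝓡 4) 𝓘(ℝ) F y :=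
  (hF.contMDiffAt hy).mdifferentiableAt (by simp)

lemma smoothField_coordField (a : TangentSpace (𝓡 4) x) : SmoothField x (coordField a) :=
  fun _ hy ↦ (contMDiffAt_coordField a hy).contMDiffWithinAt

lemma contDiffAt_comp_chart_symm {F : M → ℝ} {k : WithTop ℕ∞} (hk : k ≤ ∞)
    (hF : ContMDiffAt (𝓡 4) 𝓘(ℝ) k F x) :
    ContDiffAt ℝ k (F ∘ (extChartAt (𝓡 4) x).symm) (extChartAt (𝓡 4) x x) := by
  have h2 := contMDiffWithinAt_extChartAt_symm_range (I := 𝓡 4) (n := ∞) x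
    (mem_extChartAt_target (I := 𝓡 4) x)
  rw [ModelWithCorners.range_eq_univ, contMDiffWithinAt_univ] at h2
  rw [← contMDiffAt_iff_contDiffAt]
  refine ContMDiffAt.comp_of_eq (y := x) hF (h2.of_le hk) ?_
  simp

lemma differentiableAt_comp_chart_symm {F : M → ℝ} (hF : MDifferentiableAt (𝓡 4) 𝓘(ℝ) F x) :
    DifferentiableAt ℝ (F ∘ (extChartAt (𝓡 4) x).symm) (extChartAt (𝓡 4) x x) := by
  rw [← mdifferentiableAt_iff_differentiableAt]
  exact MDifferentiableAt.comp_of_eq (I' := 𝓡 4) (y := x) _ hF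
    (mdifferentiableAt_extChartAt_symm' (x := x) (mem_extChartAt_target (I := 𝓡 4) x))
    (extChartAt_to_inv x)

lemma chartDeriv_congr {F F' : M → ℝ} (h : F =ᶠ[nhds x] F') :
    chartDeriv x F = chartDeriv x F' := by
  refine Filter.EventuallyEq.fderiv_eq ?_
  have hc : ContinuousAt (extChartAt (𝓡 4) x).symm (extChartAt (𝓡 4) x x) :=
    continuousAt_extChartAt_symm x
  rw [ContinuousAt, extChartAt_to_inv] at hc
  exact hc.eventually h

lemma mfderiv_eq_chartDeriv {F : M → ℝ} (hF : MDifferentiableAt (𝓡 4) 𝓘(ℝ) F x)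
    (a : TangentSpace (𝓡 4) x) :
    mfderiv (𝓡 4) 𝓘(ℝ) F x a = chartDeriv x F a := by
  have := mfderiv_coordField a (mem_chart_source _ x) hF
  rwa [coordField_self] at this

/-- Second derivatives along coordinate fields commute. -/
lemma chartDeriv_mfderiv_comm {F : M → ℝ} (hF : SmoothFn x F) (a b : TangentSpace (𝓡 4) x) :
    chartDeriv x (fun y ↦ mfderiv (𝓡 4) 𝓘(ℝ) F y (coordField b y)) a
      = chartDeriv x (fun y ↦ mfderiv (𝓡 4) 𝓘(ℝ) F y (coordField a y)) b := by
  set φ := extChartAt (𝓡 4) x with hφ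
  have hsm : ContDiffAt ℝ ∞ (F ∘ φ.symm) (φ x) :=
    contDiffAt_comp_chart_symm le_rfl (hF.contMDiffAt (mem_chart_source _ x))
  have key (b : TangentSpace (𝓡 4) x) :
      (fun y ↦ (mfderiv (𝓡 4) 𝓘(ℝ) F y (coordField b y) : ℝ)) ∘ φ.symm
        =ᶠ[nhds (φ x)] fun z ↦ fderiv ℝ (F ∘ φ.symm) z b := by
    have ht : φ.target ∈ nhds (φ x) := extChartAt_target_mem_nhds x
    filter_upwards [ht] with z hz
    have hy : φ.symm z ∈ (chartAt (EuclideanSpace ℝ (Fin 4)) x).source := by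
      simpa [hφ] using φ.map_target hz
    have := mfderiv_coordField b hy (hF.mdifferentiableAt hy)
    rw [← hφ, φ.right_inv hz] at this
    exact this
  have hd : DifferentiableAt ℝ (fderiv ℝ (F ∘ φ.symm)) (φ x) :=
    (hsm.fderiv_right (m := 1) (right_eq_inf.mp rfl)).differentiableAt one_ne_zero
  have key2 (a b : EuclideanSpace ℝ (Fin 4)) :
      fderiv ℝ (fun z ↦ fderiv ℝ (F ∘ φ.symm) z b) (φ x) a
        = fderiv ℝ (fderiv ℝ (F ∘ φ.symm)) (φ x) a b := by
    rw [fderiv_clm_apply hd (differentiableAt_const b)]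
    simp
  have hsymm := hsm.isSymmSndFDerivAt
    (by rw [minSmoothness_of_isRCLikeNormedField]; exact ENat.LEInfty.out)
  have h1 := DFunLike.congr_fun ((key b).fderiv_eq (𝕜 := ℝ)) a
  have h2 := DFunLike.congr_fun ((key a).fderiv_eq (𝕜 := ℝ)) b
  exact h1.trans ((key2 a b).trans ((hsymm a b).trans ((key2 b a).symm.trans h2.symm)))

end ChartDerivative

/-! ### Covariant differentiation along coordinate fields, and curvature -/

section Connection

variable {M : Type v} [TopologicalSpace M]
  [ChartedSpace (EuclideanSpace ℝ (Fin 4)) M] [IsManifold (𝓡 4) ∞ M] {x y : M}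

lemma LorentzMetric.contMDiffAt_val (g : LorentzMetric M) {Y Z : ∀ y : M, TangentSpace (𝓡 4) y}
    (hY : ContMDiffAt (𝓡 4) (𝓡 4).tangent ∞ (fun y ↦ (Y y : TangentBundle (𝓡 4) M)) x)
    (hZ : ContMDiffAt (𝓡 4) (𝓡 4).tangent ∞ (fun y ↦ (Z y : TangentBundle (𝓡 4) M)) x) :
    ContMDiffAt (𝓡 4) 𝓘(ℝ) ∞ (fun y ↦ g.val y (Y y) (Z y)) x := by
  have : ContMDiffAt (𝓡 4) ((𝓡 4).prod 𝓘(ℝ)) ∞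
      (fun m ↦ Bundle.TotalSpace.mk' ℝ (E := Bundle.Trivial M ℝ) m (g.val m (Y m) (Z m))) x := by
    apply ContMDiffAt.clm_bundle_apply₂ (F₁ := EuclideanSpace ℝ (Fin 4))
      (F₂ := EuclideanSpace ℝ (Fin 4))
    · exact g.smooth.contMDiffAt
    · exact hY
    · exact hZ
  simp only [Bundle.contMDiffAt_totalSpace] at this
  exact this.2

lemma LorentzMetric.smoothFn_val (g : LorentzMetric M) {Y Z : ∀ y : M, TangentSpace (𝓡 4) y}
    (hY : SmoothField x Y) (hZ : SmoothField x Z) : SmoothFn x (fun y ↦ g.val y (Y y) (Z y)) :=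
  fun _ hy ↦ (g.contMDiffAt_val (hY.contMDiffAt hy) (hZ.contMDiffAt hy)).contMDiffWithinAt

namespace RiemannCartan

variable (G : RiemannCartan M)

/-- The covariant derivative along a coordinate field of the chart at `x`. -/
def cov {x : M} (a : TangentSpace (𝓡 4) x) (Y : ∀ y : M, TangentSpace (𝓡 4) y) (y : M) :
    TangentSpace (𝓡 4) y :=
  G.nabla Y y (coordField a y)

lemma cov_self (a : TangentSpace (𝓡 4) x) (Y : ∀ y : M, TangentSpace (𝓡 4) y) :
    G.cov a Y x = G.nabla Y x a := by
  rw [cov, coordField_self]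

/-- Smoothness of the connection is available for globally smooth fields, while `Y` is smooth only
on the chart domain. Near each point a bump function replaces `Y` by a global field, and the
covariant derivative is local. -/
lemma smoothField_cov [T2Space M] {Y : ∀ y : M, TangentSpace (𝓡 4) y} (hY : SmoothField x Y)
    (a : TangentSpace (𝓡 4) x) : SmoothField x (G.cov a Y) := by
  intro y hy
  have hs := (chartAt (EuclideanSpace ℝ (Fin 4)) x).open_source
  obtain ⟨σ, hσ, hσY⟩ := exists_contMDiff_eventuallyEq hs hy hY
  have h1 := G.nabla_smooth.contMDiff.contMDiff (σ := σ) (by simpa using hσ.contMDiffOn)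
  have h2 : ContMDiffAt (𝓡 4) (𝓡 4).tangent ∞
      (fun z ↦ (G.nabla σ z (coordField a z) : TangentBundle (𝓡 4) M)) y :=
    ContMDiffAt.clm_bundle_apply (F₁ := EuclideanSpace ℝ (Fin 4)) (F₂ := EuclideanSpace ℝ (Fin 4))
      (h1.contMDiffAt Filter.univ_mem) (contMDiffAt_coordField a hy)
  refine (h2.congr_of_eventuallyEq ?_).contMDiffWithinAt
  filter_upwards [hσY.eventually_nhds, hs.mem_nhds hy] with z hz hzs
  have := G.nabla.isCovariantDerivativeOn.congr_of_eventuallyEq (s := Set.univ)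
    (hY.mdifferentiableAt hzs) (hσ.mdifferentiable (by simp) z) Filter.univ_mem
    (hz.mono fun _ h ↦ h.symm)
  simp only [cov, this]

lemma mfderiv_val {Y Z : ∀ y : M, TangentSpace (𝓡 4) y} (hY : SmoothField x Y)
    (hZ : SmoothField x Z) (a : TangentSpace (𝓡 4) x)
    (hy : y ∈ (chartAt (EuclideanSpace ℝ (Fin 4)) x).source) :
    mfderiv (𝓡 4) 𝓘(ℝ) (fun y ↦ G.g.val y (Y y) (Z y)) y (coordField a y)
      = G.g.val y (G.cov a Y y) (Z y) + G.g.val y (Y y) (G.cov a Z y) :=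
  G.nabla_metric Y Z y (hY.mdifferentiableAt hy) (hZ.mdifferentiableAt hy) _

lemma chartDeriv_val {Y Z : ∀ y : M, TangentSpace (𝓡 4) y} (hY : SmoothField x Y)
    (hZ : SmoothField x Z) (a : TangentSpace (𝓡 4) x) :
    chartDeriv x (fun y ↦ G.g.val y (Y y) (Z y)) a
      = G.g.val x (G.cov a Y x) (Z x) + G.g.val x (Y x) (G.cov a Z x) := by
  rw [← mfderiv_eq_chartDeriv ((G.g.smoothFn_val hY hZ).mdifferentiableAt (mem_chart_source _ x)),
    ← mfderiv_val G hY hZ a (mem_chart_source _ x), coordField_self]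

lemma chartDeriv_add {F F' : M → ℝ} (hF : MDifferentiableAt (𝓡 4) 𝓘(ℝ) F x)
    (hF' : MDifferentiableAt (𝓡 4) 𝓘(ℝ) F' x) (a : EuclideanSpace ℝ (Fin 4)) :
    chartDeriv x (fun y ↦ F y + F' y) a = chartDeriv x F a + chartDeriv x F' a := by
  have h := fderiv_add (differentiableAt_comp_chart_symm hF) (differentiableAt_comp_chart_symm hF')
  exact congrArg (fun L ↦ L a) h

lemma chartDeriv_mul {F F' : M → ℝ} (hF : MDifferentiableAt (𝓡 4) 𝓘(ℝ) F x)
    (hF' : MDifferentiableAt (𝓡 4) 𝓘(ℝ) F' x) (a : EuclideanSpace ℝ (Fin 4)) :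
    chartDeriv x (fun y ↦ F y * F' y) a
      = F x * chartDeriv x F' a + F' x * chartDeriv x F a := by
  have h := fderiv_mul (differentiableAt_comp_chart_symm hF) (differentiableAt_comp_chart_symm hF')
  have h2 := congrArg (fun L ↦ L a) h
  simpa using! h2

/-- The curvature operator is skew for the metric. -/
lemma val_commutator [T2Space M] {Y Z : ∀ y : M, TangentSpace (𝓡 4) y} (hY : SmoothField x Y)
    (hZ : SmoothField x Z) (a b : TangentSpace (𝓡 4) x) :
    G.g.val x (G.cov a (G.cov b Y) x - G.cov b (G.cov a Y) x) (Z x)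
      = -G.g.val x (Y x) (G.cov a (G.cov b Z) x - G.cov b (G.cov a Z) x) := by
  have second (a b : TangentSpace (𝓡 4) x) :
      chartDeriv x (fun y ↦ mfderiv (𝓡 4) 𝓘(ℝ) (fun y ↦ G.g.val y (Y y) (Z y)) y (coordField b y)) a
        = G.g.val x (G.cov a (G.cov b Y) x) (Z x) + G.g.val x (G.cov b Y x) (G.cov a Z x)
          + (G.g.val x (G.cov a Y x) (G.cov b Z x) + G.g.val x (Y x) (G.cov a (G.cov b Z) x)) := by
    have hbY := G.smoothField_cov hY b
    have hbZ := G.smoothField_cov hZ b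
    have h1 : (fun y ↦ (mfderiv (𝓡 4) 𝓘(ℝ) (fun y ↦ G.g.val y (Y y) (Z y)) y (coordField b y) : ℝ))
        =ᶠ[nhds x] fun y ↦ G.g.val y (G.cov b Y y) (Z y) + G.g.val y (Y y) (G.cov b Z y) := by
      filter_upwards [(chartAt (EuclideanSpace ℝ (Fin 4)) x).open_source.mem_nhds
        (mem_chart_source _ x)] with y hy using G.mfderiv_val hY hZ b hy
    have h2 := congrArg (fun L ↦ L a) (chartDeriv_congr h1)
    refine h2.trans ?_
    have h3 := chartDeriv_add
      ((G.g.smoothFn_val hbY hZ).mdifferentiableAt (mem_chart_source _ x))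
      ((G.g.smoothFn_val hY hbZ).mdifferentiableAt (mem_chart_source _ x)) a
    refine h3.trans ?_
    rw [G.chartDeriv_val hbY hZ, G.chartDeriv_val hY hbZ]
  -- Second partial derivatives of the scalar product commute, and the terms with one derivative on
  -- each factor are symmetric in `a` and `b`, so they cancel.
  have hc := chartDeriv_mfderiv_comm (G.g.smoothFn_val hY hZ) a b
  rw [second a b, second b a] at hc
  simp only [map_sub, sub_apply]
  linarith

/-- The bracket term of the curvature vanishes because coordinate fields commute. -/
lemma riemann_eq (a b c : TangentSpace (𝓡 4) x) :
    G.riemann x a b c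
      = G.cov b (G.cov a (coordField c)) x - G.cov a (G.cov b (coordField c)) x := by
  have h := mlieBracket_coordField a b (mem_chart_source _ x)
  rw [riemann, curvature, h, map_zero, add_zero]
  rfl

lemma cov_add {Y Z : ∀ y : M, TangentSpace (𝓡 4) y} (hY : SmoothField x Y) (hZ : SmoothField x Z)
    (a : TangentSpace (𝓡 4) x) :
    G.cov a (fun y ↦ Y y + Z y) x = G.cov a Y x + G.cov a Z x := by
  have := G.nabla.isCovariantDerivativeOn.add (s := Set.univ)
    (hY.mdifferentiableAt (mem_chart_source _ x)) (hZ.mdifferentiableAt (mem_chart_source _ x))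
  exact congrArg (fun L ↦ L (coordField a x)) this

lemma cov_smul {Y : ∀ y : M, TangentSpace (𝓡 4) y} (hY : SmoothField x Y) {F : M → ℝ}
    (hF : MDifferentiableAt (𝓡 4) 𝓘(ℝ) F x) (a : TangentSpace (𝓡 4) x) :
    G.cov a (fun y ↦ F y • Y y) x = F x • G.cov a Y x + chartDeriv x F a • Y x := by
  have := G.nabla.isCovariantDerivativeOn.leibniz (s := Set.univ)
    (hY.mdifferentiableAt (mem_chart_source _ x)) hF
  have h2 := congrArg (fun L ↦ L (coordField a x)) this
  rw [← mfderiv_eq_chartDeriv hF a]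
  rw [coordField_self] at h2
  rw [cov_self, cov_self]
  exact h2

lemma cov_congr {Y Z : ∀ y : M, TangentSpace (𝓡 4) y} (hY : SmoothField x Y)
    (hZ : SmoothField x Z)
    (h : ∀ y ∈ (chartAt (EuclideanSpace ℝ (Fin 4)) x).source, Y y = Z y)
    (a : TangentSpace (𝓡 4) x) : G.cov a Y x = G.cov a Z x := by
  have := G.nabla.isCovariantDerivativeOn.congr_of_eqOn
    (hY.mdifferentiableAt (mem_chart_source _ x)) (hZ.mdifferentiableAt (mem_chart_source _ x))
    ((chartAt (EuclideanSpace ℝ (Fin 4)) x).open_source.mem_nhds (mem_chart_source _ x)) h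
  simp only [cov, this]

end RiemannCartan

end Connection

/-! ### The Bianchi identity and the vanishing divergence of the spin density -/

section Closed

set_option linter.unusedSectionVars false

variable {M : Type v} [TopologicalSpace M]
  [ChartedSpace (EuclideanSpace ℝ (Fin 4)) M] [IsManifold (𝓡 4) ∞ M] {x y : M}

lemma SmoothField.smul {F : M → ℝ} {Y : ∀ y : M, TangentSpace (𝓡 4) y} (hF : SmoothFn x F)
    (hY : SmoothField x Y) : SmoothField x (fun y ↦ F y • Y y) :=
  ContMDiffOn.smul_section hF hY

lemma SmoothField.add {Y Z : ∀ y : M, TangentSpace (𝓡 4) y} (hY : SmoothField x Y)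
    (hZ : SmoothField x Z) : SmoothField x (fun y ↦ Y y + Z y) :=
  ContMDiffOn.add_section hY hZ

lemma SmoothField.sub {Y Z : ∀ y : M, TangentSpace (𝓡 4) y} (hY : SmoothField x Y)
    (hZ : SmoothField x Z) : SmoothField x (fun y ↦ Y y - Z y) :=
  ContMDiffOn.sub_section hY hZ

lemma SmoothFn.const_mul {F : M → ℝ} (hF : SmoothFn x F) (c : ℝ) :
    SmoothFn x (fun y ↦ c * F y) :=
  contMDiffOn_const.mul hF

lemma chartDeriv_const (r : ℝ) (a : TangentSpace (𝓡 4) x) : chartDeriv x (fun _ : M ↦ r) a = 0 :=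
  DFunLike.congr_fun (fderiv_const_apply (𝕜 := ℝ) (x := extChartAt (𝓡 4) x x) r) a

lemma chartDeriv_const_mul {F : M → ℝ} (r : ℝ) (hF : MDifferentiableAt (𝓡 4) 𝓘(ℝ) F x)
    (a : TangentSpace (𝓡 4) x) :
    chartDeriv x (fun y ↦ r * F y) a = r * chartDeriv x F a := by
  have := RiemannCartan.chartDeriv_mul (x := x) (F := fun _ ↦ r) mdifferentiableAt_const hF a
  rwa [chartDeriv_const, mul_zero, add_zero] at this

namespace RiemannCartan

variable (G : RiemannCartan M)

/-- Allows the trace to be taken in a frame adapted to `u`. Independence of the frame needs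
linearity of the curvature in the traced slot, which follows from linearity of `coordField` in its
initial vector. -/
lemma ricci_eq [T2Space M] {f : Module.Basis (Fin 4) ℝ (TangentSpace (𝓡 4) x)}
    (hf : G.g.IsOrthonormal f) (a b : TangentSpace (𝓡 4) x) :
    G.ricci x a b = ∑ i, eta i * G.g.val x (G.cov (f i) (G.cov a (coordField b)) x
      - G.cov a (G.cov (f i) (coordField b)) x) (f i) := by
  have h := (G.frame_isOrthonormal x).trace_eq hf
    (fun c d ↦ G.g.val x (G.riemann x a c b) d) ?_ ?_ (fun _ _ _ ↦ map_add _ _ _)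
    (fun _ _ _ ↦ map_smul _ _ _)
  · simp only [G.riemann_eq] at h
    rw [← h, ricci]
    simp only [G.riemann_eq]
  · intro c c' d
    have hadd : G.cov a (G.cov (c + c') (coordField b)) x
        = G.cov a (G.cov c (coordField b)) x + G.cov a (G.cov c' (coordField b)) x := by
      have h1 := G.smoothField_cov (smoothField_coordField b) c
      have h2 := G.smoothField_cov (smoothField_coordField b) c'
      rw [← G.cov_add h1 h2]
      refine G.cov_congr (G.smoothField_cov (smoothField_coordField b) _) (h1.add h2) ?_ a
      intro y hy
      rw [cov, coordField_add _ _ hy, map_add]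
      rfl
    rw [← add_apply, ← map_add, G.riemann_eq, G.riemann_eq, G.riemann_eq, hadd]
    congr 2
    simp only [cov_self, map_add]
    abel
  · intro r c d
    have hsmul : G.cov a (G.cov (r • c) (coordField b)) x
        = r • G.cov a (G.cov c (coordField b)) x := by
      have h1 := G.smoothField_cov (smoothField_coordField b) c
      have h2 : SmoothFn x (fun _ : M ↦ r) := contMDiffOn_const
      have h3 := G.cov_smul h1 (F := fun _ ↦ r) mdifferentiableAt_const a
      rw [chartDeriv_const, zero_smul, add_zero] at h3
      rw [← h3]
      refine G.cov_congr (G.smoothField_cov (smoothField_coordField b) _) (h1.smul h2) ?_ a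
      intro y hy
      rw [cov, coordField_smul _ _ hy, map_smul]
      rfl
    rw [G.riemann_eq, G.riemann_eq, hsmul, ← smul_eq_mul, ← smul_apply, ← map_smul]
    congr 2
    simp only [cov_self, map_smul, smul_sub]

end RiemannCartan

namespace SpinningCosmology

variable (C : SpinningCosmology M)

lemma smoothField_u (x : M) : SmoothField x C.u := C.u_smooth.contMDiffOn

/-- The spin density evaluated on two coordinate fields. -/
def spinFn {x : M} (a b : TangentSpace (𝓡 4) x) (y : M) : ℝ :=
  C.spin y (coordField a y) (coordField b y)

lemma spinFn_self (a b : TangentSpace (𝓡 4) x) : C.spinFn a b x = C.spin x a b := by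
  rw [spinFn, coordField_self, coordField_self]

lemma cov_coordField_sub (a b : TangentSpace (𝓡 4) x)
    (hy : y ∈ (chartAt (EuclideanSpace ℝ (Fin 4)) x).source) :
    C.cov a (coordField b) y - C.cov b (coordField a) y = (2 * C.spinFn a b y) • C.u y := by
  have h := C.nabla.torsion_apply ((smoothField_coordField a).mdifferentiableAt hy)
    ((smoothField_coordField b).mdifferentiableAt hy)
  rw [mlieBracket_coordField a b hy, sub_zero, C.torsion_eq] at h
  exact h.symm

lemma smoothFn_spinFn [T2Space M] (a b : TangentSpace (𝓡 4) x) : SmoothFn x (C.spinFn a b) := by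
  have h1 := (C.smoothField_cov (smoothField_coordField b) a).sub
    (C.smoothField_cov (smoothField_coordField a) b)
  have h2 := (C.g.smoothFn_val h1 (C.smoothField_u x)).const_mul (-(1 / 2))
  refine h2.congr fun y hy ↦ ?_
  rw [C.cov_coordField_sub a b hy, map_smul, smul_apply, C.u_unit, smul_eq_mul]
  ring

/-- This is the derivative along `c` of the torsion identity `cov_coordField_sub`, the ingredient of
the first Bianchi identity with torsion. -/
lemma cov_cov_coordField_sub [T2Space M] (a b c : TangentSpace (𝓡 4) x) :
    C.cov c (C.cov a (coordField b)) x = C.cov c (C.cov b (coordField a)) x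
      + ((2 * C.spin x a b) • C.nabla C.u x c
        + (2 * chartDeriv x (C.spinFn a b) c) • C.u x) := by
  have hS := C.smoothFn_spinFn a b
  have h2S := hS.const_mul 2
  have hba := C.smoothField_cov (smoothField_coordField a) b
  have hd := chartDeriv_const_mul 2 (hS.mdifferentiableAt (mem_chart_source _ x)) c
  rw [← hd, ← C.spinFn_self, ← C.cov_self c C.u,
    ← C.cov_smul (C.smoothField_u x) (h2S.mdifferentiableAt (mem_chart_source _ x)),
    ← C.cov_add hba ((C.smoothField_u x).smul h2S)]
  refine C.cov_congr (C.smoothField_cov (smoothField_coordField b) a)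
    (hba.add ((C.smoothField_u x).smul h2S)) ?_ c
  intro y hy
  rw [← C.cov_coordField_sub a b hy]
  abel

/-- The first Bianchi identity paired with `a`. Its torsion corrections vanish: they are multiples
of `u`, which is orthogonal to `a`, or carry the spin density on `u`, or the acceleration of `u`.
The curvature term acting on `a` drops out by skewness. -/
lemma val_curvature_eq [T2Space M] {a b : TangentSpace (𝓡 4) x} (ha : C.g.val x (C.u x) a = 0) :
    C.g.val x (C.cov a (C.cov (C.u x) (coordField b)) x
        - C.cov (C.u x) (C.cov a (coordField b)) x) a
      = C.g.val x (C.cov a (C.cov b C.u) x - C.cov b (C.cov a C.u) x) a := by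
  have e1 := C.cov_cov_coordField_sub (C.u x) b a
  have e2 := C.cov_cov_coordField_sub a b (C.u x)
  have e3 := C.cov_cov_coordField_sub (C.u x) a b
  rw [C.spin_u_left] at e1 e3
  rw [C.acceleration_free] at e2
  have r1 := C.val_commutator (smoothField_coordField a) (smoothField_coordField a) b (C.u x)
  -- Together with the next identity this replaces the coordinate extension of `C.u x` by the field
  -- `C.u` itself: skewness moves the curvature onto `a`, where only the value at `x` matters.
  have r2 := C.val_commutator (smoothField_coordField (C.u x)) (smoothField_coordField a) a b
  have r3 := C.val_commutator (C.smoothField_u x) (smoothField_coordField a) a b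
  rw [C.g.symm x (coordField a x)] at r1
  simp only [coordField_self] at r1 r2 r3
  rw [r3, ← r2]
  simp only [e1, e2, map_sub, map_add, map_smul, sub_apply, add_apply, smul_apply, ha, smul_zero,
    mul_zero, zero_smul, add_zero, map_zero, zero_apply]
  simp only [e3, map_sub, map_add, map_smul, sub_apply, add_apply, smul_apply, ha, smul_zero,
    mul_zero, zero_smul, add_zero, map_zero, zero_apply] at r1
  linarith

lemma smoothFn_h (a b : TangentSpace (𝓡 4) x) :
    SmoothFn x (fun y ↦ C.h C.u y (coordField a y) (coordField b y)) :=
  (C.g.smoothFn_val (smoothField_coordField a) (smoothField_coordField b)).add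
    ((C.g.smoothFn_val (C.smoothField_u x) (smoothField_coordField a)).mul
      (C.g.smoothFn_val (C.smoothField_u x) (smoothField_coordField b)))

/-- The expansion is defined through frames chosen pointwise without continuity. Its smoothness is
recovered from `val_nabla_u` on the diagonal, where the spin density vanishes: it is three times a
quotient of smooth functions. -/
lemma mdifferentiableAt_expansion [T2Space M] (x : M) :
    MDifferentiableAt (𝓡 4) 𝓘(ℝ) (C.expansion C.u) x := by
  obtain ⟨f, hf, hf0⟩ := LorentzMetric.exists_isOrthonormal_zero_eq (g := C.g) (C.u x) (C.u_unit x)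
  have h1 : C.h C.u x (coordField (f 1) x) (coordField (f 1) x) ≠ 0 := by
    simp [RiemannCartan.h, ← hf0, hf _ _, eta]
  have hA := C.g.smoothFn_val (C.smoothField_cov (C.smoothField_u x) (f 1))
    (smoothField_coordField (f 1))
  have hH := C.smoothFn_h (f 1) (f 1)
  have hdiv := ((hA.contMDiffAt (mem_chart_source _ x)).div₀
    (hH.contMDiffAt (mem_chart_source _ x)) h1)
  have h3 := (contMDiffAt_const (I := 𝓡 4) (x := x) (n := ∞) (c := (3 : ℝ))).mul hdiv
  refine (h3.congr_of_eventuallyEq ?_).mdifferentiableAt (by simp)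
  have hne := (hH.contMDiffAt (mem_chart_source _ x)).continuousAt.eventually_ne h1
  filter_upwards [hne] with y hy
  have := C.val_nabla_u y (coordField (f 1) y) (coordField (f 1) y)
  rw [C.spin_self] at this
  simp only [Pi.mul_apply, Pi.div_apply, RiemannCartan.cov]
  rw [this]
  field_simp
  ring

lemma chartDeriv_expansion [T2Space M] {a : TangentSpace (𝓡 4) x}
    (ha : C.g.val x (C.u x) a = 0) : chartDeriv x (C.expansion C.u) a = 0 := by
  rw [← mfderiv_eq_chartDeriv (C.mdifferentiableAt_expansion x)]
  have := C.expansion_homogeneous x a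
  rwa [C.proj_apply, ha, zero_smul, add_zero] at this

lemma chartDeriv_h {a b : TangentSpace (𝓡 4) x} (c : TangentSpace (𝓡 4) x)
    (ha : C.g.val x (C.u x) a = 0) (hb : C.g.val x (C.u x) b = 0) :
    chartDeriv x (fun y ↦ C.h C.u y (coordField a y) (coordField b y)) c
      = C.g.val x (C.cov c (coordField a) x) b + C.g.val x a (C.cov c (coordField b) x) := by
  have hG := C.g.smoothFn_val (smoothField_coordField a) (smoothField_coordField b)
  have hUa := C.g.smoothFn_val (C.smoothField_u x) (smoothField_coordField a)
  have hUb := C.g.smoothFn_val (C.smoothField_u x) (smoothField_coordField b)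
  have hx := mem_chart_source (EuclideanSpace ℝ (Fin 4)) x
  have h1 := RiemannCartan.chartDeriv_add (hG.mdifferentiableAt hx)
    ((SmoothFn.mdifferentiableAt (hUa.mul hUb) hx)) c
  have h2 := RiemannCartan.chartDeriv_mul (hUa.mdifferentiableAt hx) (hUb.mdifferentiableAt hx) c
  have h3 := C.chartDeriv_val (smoothField_coordField a) (smoothField_coordField b) c
  simp only [coordField_self, ha, hb, zero_mul, add_zero] at h2 h3
  refine Eq.trans h1 ?_
  rw [h3]
  erw [h2]
  simp

/-- Differentiate `val_nabla_u` along `c`. The expansion is constant in this direction, and the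
derivative falling on `b` cancels one of the two terms from the derivative of `h`. -/
lemma val_cov_cov_u [T2Space M] {a b c : TangentSpace (𝓡 4) x} (ha : C.g.val x (C.u x) a = 0)
    (hb : C.g.val x (C.u x) b = 0) (hc : C.g.val x (C.u x) c = 0) :
    C.g.val x (C.cov c (C.cov a C.u) x) b
      = C.expansion C.u x / 3 * C.g.val x (C.cov c (coordField a) x) b
        + chartDeriv x (C.spinFn a b) c - C.spin x a (C.cov c (coordField b) x) := by
  have hx := mem_chart_source (EuclideanSpace ℝ (Fin 4)) x
  have h1 := C.chartDeriv_val (C.smoothField_cov (C.smoothField_u x) a)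
    (smoothField_coordField b) c
  have hθ : MDifferentiableAt (𝓡 4) 𝓘(ℝ) (fun y ↦ 1 / 3 * C.expansion C.u y) x :=
    mdifferentiableAt_const.mul (C.mdifferentiableAt_expansion x)
  have hH := (C.smoothFn_h a b).mdifferentiableAt hx
  have hS := (C.smoothFn_spinFn a b).mdifferentiableAt hx
  have h2 : (fun y ↦ C.g.val y (C.cov a C.u y) (coordField b y)) = fun y ↦
      (1 / 3 * C.expansion C.u y) * C.h C.u y (coordField a y) (coordField b y)
        + C.spinFn a b y := by
    funext y
    rw [RiemannCartan.cov, C.val_nabla_u, spinFn]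
    ring
  have h3 := RiemannCartan.chartDeriv_add (hθ.mul hH) hS c
  have h4 := RiemannCartan.chartDeriv_mul hθ hH c
  have h5 := chartDeriv_const_mul (1 / 3) (C.mdifferentiableAt_expansion x) c
  rw [C.chartDeriv_expansion hc] at h5
  rw [C.chartDeriv_h c ha hb, h5] at h4
  rw [h2] at h1
  have h6 := h1.symm.trans (h3.trans (congrArg (· + _) h4))
  rw [C.cov_self a C.u, C.val_nabla_u] at h6
  simp only [coordField_self, RiemannCartan.h, ha] at h6
  simp only [zero_mul, add_zero, mul_zero] at h6
  linarith

/-- The spin density is divergence free on the orthogonal complement of the 4-velocity. -/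
lemma sum_div_spin [T2Space M] {f : Module.Basis (Fin 4) ℝ (TangentSpace (𝓡 4) x)}
    (hf : C.g.IsOrthonormal f) (hf0 : f 0 = C.u x) (k : Fin 3) :
    ∑ i : Fin 3, (chartDeriv x (C.spinFn (f k.succ) (f i.succ)) (f i.succ)
      - C.spin x (f k.succ) (C.cov (f i.succ) (coordField (f i.succ)) x)
      + C.spin x (f i.succ) (C.cov (f k.succ) (coordField (f i.succ)) x)) = 0 := by
  have hperp (i : Fin 3) : C.g.val x (C.u x) (f i.succ) = 0 := by
    rw [← hf0, hf, if_neg (Fin.succ_ne_zero i).symm]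
  have hR := C.ricci_u x (f k.succ) (hperp k)
  -- The timelike term of the trace is the commutator of `u` with itself, so only the spatial frame
  -- vectors contribute.
  rw [C.ricci_eq hf, Fin.sum_univ_succ, hf0, sub_self, map_zero, zero_apply, mul_zero,
    zero_add] at hR
  rw [← hR]
  refine Finset.sum_congr rfl fun i _ ↦ ?_
  have heta : eta i.succ = 1 := by simp [eta]
  rw [heta, one_mul, C.val_curvature_eq (hperp i), map_sub, sub_apply,
    C.val_cov_cov_u (hperp k) (hperp i) (hperp i), C.val_cov_cov_u (hperp i) (hperp i) (hperp k)]
  have h0 : chartDeriv x (C.spinFn (f i.succ) (f i.succ)) (f k.succ) = 0 := by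
    have : C.spinFn (f i.succ) (f i.succ) = fun _ ↦ 0 := funext fun y ↦ C.spin_self y _
    rw [this, chartDeriv_const]
  -- The connection is symmetric up to multiples of `u`; hence the two expansion terms cancel.
  have h1 : C.g.val x (C.cov (f i.succ) (coordField (f k.succ)) x) (f i.succ)
      = C.g.val x (C.cov (f k.succ) (coordField (f i.succ)) x) (f i.succ) := by
    have := C.cov_coordField_sub (f i.succ) (f k.succ) (mem_chart_source _ x)
    rw [← sub_eq_zero, ← sub_apply, ← map_sub, this, map_smul, smul_apply, hperp, smul_zero]
  rw [h0, h1]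
  ring

end SpinningCosmology

end Closed

/-- The derivative of a symmetric `3 × 3` determinant at the identity is the trace. -/
lemma hasFDerivAt_det_three {E : Type*} [NormedAddCommGroup E] [NormedSpace ℝ E]
    {H₁₁ H₂₂ H₃₃ H₁₂ H₁₃ H₂₃ : E → ℝ} {d₁₁ d₂₂ d₃₃ d₁₂ d₁₃ d₂₃ : E →L[ℝ] ℝ} {z : E}
    (h₁₁ : HasFDerivAt H₁₁ d₁₁ z) (h₂₂ : HasFDerivAt H₂₂ d₂₂ z) (h₃₃ : HasFDerivAt H₃₃ d₃₃ z)
    (h₁₂ : HasFDerivAt H₁₂ d₁₂ z) (h₁₃ : HasFDerivAt H₁₃ d₁₃ z) (h₂₃ : HasFDerivAt H₂₃ d₂₃ z)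
    (v₁₁ : H₁₁ z = 1) (v₂₂ : H₂₂ z = 1) (v₃₃ : H₃₃ z = 1)
    (v₁₂ : H₁₂ z = 0) (v₁₃ : H₁₃ z = 0) (v₂₃ : H₂₃ z = 0) :
    HasFDerivAt (fun z ↦ H₁₁ z * (H₂₂ z * H₃₃ z - H₂₃ z ^ 2)
        - H₁₂ z * (H₁₂ z * H₃₃ z - H₁₃ z * H₂₃ z)
        + H₁₃ z * (H₁₂ z * H₂₃ z - H₁₃ z * H₂₂ z)) (d₁₁ + d₂₂ + d₃₃) z := by
  have h := ((h₁₁.mul ((h₂₂.mul h₃₃).sub (h₂₃.pow 2))).sub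
    (h₁₂.mul ((h₁₂.mul h₃₃).sub (h₁₃.mul h₂₃)))).add
    (h₁₃.mul ((h₁₂.mul h₂₃).sub (h₁₃.mul h₂₂)))
  refine h.congr_fderiv ?_
  ext e
  simp [v₁₁, v₂₂, v₃₃, v₁₂, v₁₃, v₂₃]
  ring

/-! ### Derivatives of the projected volume form and of the torsion form -/

section Closed

variable {M : Type v} [TopologicalSpace M]
  [ChartedSpace (EuclideanSpace ℝ (Fin 4)) M] [IsManifold (𝓡 4) ∞ M] {x y : M}

lemma hasFDerivAt_chartDeriv {F : M → ℝ} (hF : MDifferentiableAt (𝓡 4) 𝓘(ℝ) F x) :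
    HasFDerivAt (F ∘ (extChartAt (𝓡 4) x).symm) (chartDeriv x F) (extChartAt (𝓡 4) x x) :=
  (differentiableAt_comp_chart_symm hF).hasFDerivAt

namespace SpinningCosmology

variable (C : SpinningCosmology M)

/-- The component of the torsion vector along a coordinate field. -/
def torsionForm {x : M} (c : TangentSpace (𝓡 4) x) (y : M) : ℝ :=
  C.g.val y (C.torsionVector C.u y) (coordField c y)

/-- The projected volume form on three coordinate fields. -/
def epsFn {x : M} (a b d : TangentSpace (𝓡 4) x) (y : M) : ℝ :=
  C.eps C.u y (coordField a y) (coordField b y) (coordField d y)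

/-- The spatial metric on two coordinate fields. -/
def hFn {x : M} (a b : TangentSpace (𝓡 4) x) (y : M) : ℝ :=
  C.h C.u y (coordField a y) (coordField b y)

lemma contMDiffAt_epsFn (a b d : TangentSpace (𝓡 4) x) :
    ContMDiffAt (𝓡 4) 𝓘(ℝ) ∞ (C.epsFn a b d) x := by
  have h := C.vol_smooth ![coordField a, coordField b, coordField d, C.u] x (by
    intro i
    fin_cases i
    · exact contMDiffAt_coordField a (mem_chart_source _ x)
    · exact contMDiffAt_coordField b (mem_chart_source _ x)
    · exact contMDiffAt_coordField d (mem_chart_source _ x)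
    · exact C.u_smooth x)
  convert h using 1
  funext y
  rw [epsFn, RiemannCartan.eps]
  congr 1
  funext i
  fin_cases i <;> rfl

lemma epsFn_mul_torsionForm (a b d c : TangentSpace (𝓡 4) x) (y : M) :
    C.epsFn a b d y * C.torsionForm c y
      = C.spinFn b d y * C.hFn a c y + C.spinFn d a y * C.hFn b c y
        + C.spinFn a b y * C.hFn d c y :=
  C.eps_mul_val_torsionVector y _ _ _ _

/-- The torsion vector too is defined through arbitrary pointwise frames. The Hodge identity
exhibits its components as quotients of smooth functions by the volume form, which is nonzero on a
spatial frame. -/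
lemma contMDiffAt_torsionForm [T2Space M] (c : TangentSpace (𝓡 4) x) :
    ContMDiffAt (𝓡 4) 𝓘(ℝ) ∞ (C.torsionForm c) x := by
  obtain ⟨f, hf, hf0⟩ := LorentzMetric.exists_isOrthonormal_zero_eq (g := C.g) (C.u x) (C.u_unit x)
  have hx := mem_chart_source (EuclideanSpace ℝ (Fin 4)) x
  have hw := C.contMDiffAt_epsFn (f 1) (f 2) (f 3)
  have hw0 : C.epsFn (f 1) (f 2) (f 3) x ≠ 0 := by
    intro h0
    have := C.eps_sq C.u x (C.u_unit x) (f 1) (f 2) (f 3)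
    rw [epsFn] at h0
    simp only [coordField_self] at h0
    rw [h0] at this
    simp [RiemannCartan.h, ← hf0, hf _ _, eta] at this
  have hS (a b : TangentSpace (𝓡 4) x) := (C.smoothFn_spinFn a b).contMDiffAt hx
  have hH (a b : TangentSpace (𝓡 4) x) := (C.smoothFn_h a b).contMDiffAt hx
  have hN := (((hS (f 2) (f 3)).mul (hH (f 1) c)).add ((hS (f 3) (f 1)).mul (hH (f 2) c))).add
    ((hS (f 1) (f 2)).mul (hH (f 3) c))
  refine (hN.div₀ hw hw0).congr_of_eventuallyEq ?_
  filter_upwards [hw.continuousAt.eventually_ne hw0] with y hy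
  have := C.epsFn_mul_torsionForm (f 1) (f 2) (f 3) c y
  simp only [Pi.add_apply, Pi.mul_apply, Pi.div_apply]
  rw [eq_div_iff hy, mul_comm]
  exact this

lemma mdifferentiableAt_torsionForm [T2Space M] (c : TangentSpace (𝓡 4) x) :
    MDifferentiableAt (𝓡 4) 𝓘(ℝ) (C.torsionForm c) x :=
  (C.contMDiffAt_torsionForm c).mdifferentiableAt (by simp)

section Frame

variable {f : Module.Basis (Fin 4) ℝ (TangentSpace (𝓡 4) x)}

lemma epsFn_sq_frame (hf : C.g.IsOrthonormal f) (hf0 : f 0 = C.u x) :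
    C.epsFn (f 1) (f 2) (f 3) x ^ 2 = 1 := by
  rw [epsFn]
  simp only [coordField_self]
  rw [C.eps_sq C.u x (C.u_unit x)]
  simp [RiemannCartan.h, ← hf0, hf _ _, eta]

lemma val_u_frame (hf : C.g.IsOrthonormal f) (hf0 : f 0 = C.u x) {i : Fin 4} (hi : i ≠ 0) :
    C.g.val x (C.u x) (f i) = 0 := by
  rw [← hf0, hf, if_neg hi.symm]

lemma hFn_frame (hf : C.g.IsOrthonormal f) (hf0 : f 0 = C.u x) {i j : Fin 4} (hi : i ≠ 0) :
    C.hFn (f i) (f j) x = if i = j then 1 else 0 := by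
  rw [hFn, coordField_self, coordField_self, RiemannCartan.h, C.val_u_frame hf hf0 hi, zero_mul,
    add_zero, hf]
  simp [eta, hi]

/-- The square of the projected volume form is the Gram determinant of `h`, whose derivative at an
orthonormal frame is the trace of the derivative of `h`. Both sides are then halved. -/
lemma epsFn_mul_chartDeriv (hf : C.g.IsOrthonormal f) (hf0 : f 0 = C.u x)
    (l : TangentSpace (𝓡 4) x) :
    C.epsFn (f 1) (f 2) (f 3) x * chartDeriv x (C.epsFn (f 1) (f 2) (f 3)) l
      = C.g.val x (C.cov l (coordField (f 1)) x) (f 1)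
        + C.g.val x (C.cov l (coordField (f 2)) x) (f 2)
        + C.g.val x (C.cov l (coordField (f 3)) x) (f 3) := by
  have hx := mem_chart_source (EuclideanSpace ℝ (Fin 4)) x
  have hw := (C.contMDiffAt_epsFn (f 1) (f 2) (f 3)).mdifferentiableAt (by simp)
  have hH (a b : TangentSpace (𝓡 4) x) : HasFDerivAt (C.hFn a b ∘ (extChartAt (𝓡 4) x).symm)
      (chartDeriv x (C.hFn a b)) (extChartAt (𝓡 4) x x) :=
    hasFDerivAt_chartDeriv ((C.smoothFn_h a b).mdifferentiableAt hx)
  have hv (i j : Fin 4) (hi : i ≠ 0) : (C.hFn (f i) (f j) ∘ (extChartAt (𝓡 4) x).symm)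
      (extChartAt (𝓡 4) x x) = if i = j then 1 else 0 := by
    rw [Function.comp_apply, extChartAt_to_inv, C.hFn_frame hf hf0 hi]
  have hdet := hasFDerivAt_det_three (hH (f 1) (f 1)) (hH (f 2) (f 2)) (hH (f 3) (f 3))
    (hH (f 1) (f 2)) (hH (f 1) (f 3)) (hH (f 2) (f 3)) (hv 1 1 (by decide)) (hv 2 2 (by decide))
    (hv 3 3 (by decide)) (hv 1 2 (by decide)) (hv 1 3 (by decide)) (hv 2 3 (by decide))
  have hsq := (hasFDerivAt_chartDeriv hw).pow 2
  have heq : (fun z ↦ (C.epsFn (f 1) (f 2) (f 3) ∘ (extChartAt (𝓡 4) x).symm) z ^ 2) = _ :=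
    funext fun z ↦ C.eps_sq C.u _ (C.u_unit _) _ _ _
  have hu := hsq.unique (heq ▸ hdet)
  have hl := DFunLike.congr_fun hu l
  have hd (i : Fin 4) (hi : i ≠ 0) : chartDeriv x (C.hFn (f i) (f i)) l
      = 2 * C.g.val x (C.cov l (coordField (f i)) x) (f i) := by
    have := C.chartDeriv_h l (C.val_u_frame hf hf0 hi) (C.val_u_frame hf hf0 hi)
    rw [C.g.symm x (f i), ← two_mul] at this
    exact this
  have hr : (chartDeriv x (C.hFn (f 1) (f 1)) + chartDeriv x (C.hFn (f 2) (f 2))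
      + chartDeriv x (C.hFn (f 3) (f 3))) l = 2 * (C.g.val x (C.cov l (coordField (f 1)) x) (f 1)
        + C.g.val x (C.cov l (coordField (f 2)) x) (f 2)
        + C.g.val x (C.cov l (coordField (f 3)) x) (f 3)) := by
    change chartDeriv x (C.hFn (f 1) (f 1)) l + chartDeriv x (C.hFn (f 2) (f 2)) l
      + chartDeriv x (C.hFn (f 3) (f 3)) l = _
    rw [hd 1 (by decide), hd 2 (by decide), hd 3 (by decide)]
    ring
  have hL := hl.trans hr
  have h2 : 2 * (C.epsFn (f 1) (f 2) (f 3) x * chartDeriv x (C.epsFn (f 1) (f 2) (f 3)) l)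
      = 2 * (C.g.val x (C.cov l (coordField (f 1)) x) (f 1)
        + C.g.val x (C.cov l (coordField (f 2)) x) (f 2)
        + C.g.val x (C.cov l (coordField (f 3)) x) (f 3)) := by
    refine Eq.trans ?_ hL
    change _ = (2 • (C.epsFn (f 1) (f 2) (f 3) ((extChartAt (𝓡 4) x).symm (extChartAt (𝓡 4) x x)))
      ^ (2 - 1)) * chartDeriv x (C.epsFn (f 1) (f 2) (f 3)) l
    rw [extChartAt_to_inv]
    simp
    ring
  linarith

/-- The derivatives of the torsion form in terms of those of the spin density. -/
lemma epsFn_mul_chartDeriv_torsionForm [T2Space M] (hf : C.g.IsOrthonormal f)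
    (hf0 : f 0 = C.u x) (l : TangentSpace (𝓡 4) x) {c : Fin 4} (hc : c ≠ 0) :
    C.epsFn (f 1) (f 2) (f 3) x * chartDeriv x (C.torsionForm (f c)) l
      + (C.spin x (f 2) (f 3) * (if 1 = c then 1 else 0)
          + C.spin x (f 3) (f 1) * (if 2 = c then 1 else 0)
          + C.spin x (f 1) (f 2) * (if 3 = c then 1 else 0))
        * (C.g.val x (C.cov l (coordField (f 1)) x) (f 1)
          + C.g.val x (C.cov l (coordField (f 2)) x) (f 2)
          + C.g.val x (C.cov l (coordField (f 3)) x) (f 3))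
      = chartDeriv x (C.spinFn (f 2) (f 3)) l * (if 1 = c then 1 else 0)
        + chartDeriv x (C.spinFn (f 3) (f 1)) l * (if 2 = c then 1 else 0)
        + chartDeriv x (C.spinFn (f 1) (f 2)) l * (if 3 = c then 1 else 0)
        + C.spin x (f 2) (f 3) * (C.g.val x (C.cov l (coordField (f 1)) x) (f c)
          + C.g.val x (C.cov l (coordField (f c)) x) (f 1))
        + C.spin x (f 3) (f 1) * (C.g.val x (C.cov l (coordField (f 2)) x) (f c)
          + C.g.val x (C.cov l (coordField (f c)) x) (f 2))
        + C.spin x (f 1) (f 2) * (C.g.val x (C.cov l (coordField (f 3)) x) (f c)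
          + C.g.val x (C.cov l (coordField (f c)) x) (f 3)) := by
  have hx := mem_chart_source (EuclideanSpace ℝ (Fin 4)) x
  have hw := (C.contMDiffAt_epsFn (f 1) (f 2) (f 3)).mdifferentiableAt (by simp)
  have hs := C.mdifferentiableAt_torsionForm (f c)
  have hS (a b : TangentSpace (𝓡 4) x) := (C.smoothFn_spinFn a b).mdifferentiableAt hx
  have hH (a b : TangentSpace (𝓡 4) x) : MDifferentiableAt (𝓡 4) 𝓘(ℝ) (C.hFn a b) x :=
    (C.smoothFn_h a b).mdifferentiableAt hx
  have hsq := C.epsFn_sq_frame hf hf0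
  have hdw := C.epsFn_mul_chartDeriv hf hf0 l
  have hval := C.epsFn_mul_torsionForm (f 1) (f 2) (f 3) (f c) x
  have heq : (fun y ↦ C.epsFn (f 1) (f 2) (f 3) y * C.torsionForm (f c) y) = fun y ↦
      C.spinFn (f 2) (f 3) y * C.hFn (f 1) (f c) y + C.spinFn (f 3) (f 1) y * C.hFn (f 2) (f c) y
        + C.spinFn (f 1) (f 2) y * C.hFn (f 3) (f c) y :=
    funext fun y ↦ C.epsFn_mul_torsionForm (f 1) (f 2) (f 3) (f c) y
  -- Both sides of the Hodge identity are differentiated by the product rule; multiplication by the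
  -- volume form, of square one, removes its derivative.
  have hl := RiemannCartan.chartDeriv_mul hw hs l
  rw [heq] at hl
  have h12 := RiemannCartan.chartDeriv_add
    (((hS (f 2) (f 3)).mul (hH (f 1) (f c))).add ((hS (f 3) (f 1)).mul (hH (f 2) (f c))))
    ((hS (f 1) (f 2)).mul (hH (f 3) (f c))) l
  have h1 := RiemannCartan.chartDeriv_add
    ((hS (f 2) (f 3)).mul (hH (f 1) (f c))) ((hS (f 3) (f 1)).mul (hH (f 2) (f c))) l
  have p1 := RiemannCartan.chartDeriv_mul (hS (f 2) (f 3)) (hH (f 1) (f c)) l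
  have p2 := RiemannCartan.chartDeriv_mul (hS (f 3) (f 1)) (hH (f 2) (f c)) l
  have p3 := RiemannCartan.chartDeriv_mul (hS (f 1) (f 2)) (hH (f 3) (f c)) l
  have hd (i : Fin 4) (hi : i ≠ 0) : chartDeriv x (C.hFn (f i) (f c)) l
      = C.g.val x (C.cov l (coordField (f i)) x) (f c)
        + C.g.val x (C.cov l (coordField (f c)) x) (f i) := by
    have := C.chartDeriv_h l (C.val_u_frame hf hf0 hi) (C.val_u_frame hf hf0 hc)
    rw [C.g.symm x (f i)] at this
    exact this
  rw [hd 1 (by decide), C.hFn_frame hf hf0 (by decide), C.spinFn_self] at p1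
  rw [hd 2 (by decide), C.hFn_frame hf hf0 (by decide), C.spinFn_self] at p2
  rw [hd 3 (by decide), C.hFn_frame hf hf0 (by decide), C.spinFn_self] at p3
  rw [C.hFn_frame hf hf0 (by decide), C.hFn_frame hf hf0 (by decide),
    C.hFn_frame hf hf0 (by decide), C.spinFn_self, C.spinFn_self, C.spinFn_self] at hval
  have hall : chartDeriv x (fun y ↦ C.spinFn (f 2) (f 3) y * C.hFn (f 1) (f c) y
      + C.spinFn (f 3) (f 1) y * C.hFn (f 2) (f c) y
      + C.spinFn (f 1) (f 2) y * C.hFn (f 3) (f c) y) l = _ :=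
    h12.trans (congrArg₂ (· + ·) (h1.trans (congrArg₂ (· + ·) p1 p2)) p3)
  rw [hall] at hl
  rw [← hval]
  generalize (if 1 = c then (1 : ℝ) else 0) = δ1 at *
  generalize (if 2 = c then (1 : ℝ) else 0) = δ2 at *
  generalize (if 3 = c then (1 : ℝ) else 0) = δ3 at *
  generalize C.epsFn (f 1) (f 2) (f 3) x = κ at *
  rw [← hdw]
  linear_combination -hl + C.torsionForm (f c) x * chartDeriv x (C.epsFn (f 1) (f 2) (f 3)) l * hsq

end Frame

end SpinningCosmology

end Closed

/-! ### Closedness of the torsion form orthogonally to `u` -/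

section ClosedForm

variable {M : Type v} [TopologicalSpace M]
  [ChartedSpace (EuclideanSpace ℝ (Fin 4)) M] [IsManifold (𝓡 4) ∞ M] {x y : M}

namespace SpinningCosmology

variable (C : SpinningCosmology M)

section Frame

variable {f : Module.Basis (Fin 4) ℝ (TangentSpace (𝓡 4) x)}

lemma spin_eq_sum_frame (hf : C.g.IsOrthonormal f) (hf0 : f 0 = C.u x)
    (a v : TangentSpace (𝓡 4) x) :
    C.spin x a v = C.g.val x v (f 1) * C.spin x a (f 1) + C.g.val x v (f 2) * C.spin x a (f 2)
      + C.g.val x v (f 3) * C.spin x a (f 3) := by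
  conv_lhs => rw [← hf.sum_eq v]
  have hu : C.spin x a (f 0) = 0 := by rw [hf0, C.spin_u]
  rw [Fin.sum_univ_four, map_add, map_add, map_add, map_smul, map_smul, map_smul, map_smul, hu]
  simp [eta]

lemma chartDeriv_spinFn_swap [T2Space M] (a b : TangentSpace (𝓡 4) x) (l : TangentSpace (𝓡 4) x) :
    chartDeriv x (C.spinFn a b) l = -chartDeriv x (C.spinFn b a) l := by
  have h := chartDeriv_const_mul (-1)
    ((C.smoothFn_spinFn b a).mdifferentiableAt (mem_chart_source _ x)) l
  have h2 : C.spinFn a b = fun y ↦ -1 * C.spinFn b a y := by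
    funext y
    rw [spinFn, C.spin_antisymm, neg_one_mul, spinFn]
  rw [h2, h, neg_one_mul]

lemma chartDeriv_spinFn_self [T2Space M] (a l : TangentSpace (𝓡 4) x) :
    chartDeriv x (C.spinFn a a) l = 0 := by
  have := C.chartDeriv_spinFn_swap a a l
  linarith

lemma spin_apply_self (a : TangentSpace (𝓡 4) x) : C.spin x a a = 0 := by
  have := C.spin_antisymm x a a
  linarith

lemma val_cov_coordField_comm {a b c : TangentSpace (𝓡 4) x} (hc : C.g.val x (C.u x) c = 0) :
    C.g.val x (C.cov a (coordField b) x) c = C.g.val x (C.cov b (coordField a) x) c := by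
  have h := C.cov_coordField_sub a b (mem_chart_source _ x)
  have h2 := congrArg (fun v ↦ C.g.val x v c) h
  simp only [map_sub, map_smul, sub_apply, smul_apply, hc, smul_zero] at h2
  linarith

/-- The torsion form is closed on the orthogonal complement of `u`: the case of frame vectors. -/
lemma chartDeriv_torsionForm_frame [T2Space M] (hf : C.g.IsOrthonormal f) (hf0 : f 0 = C.u x) :
    chartDeriv x (C.torsionForm (f 1)) (f 2) = chartDeriv x (C.torsionForm (f 2)) (f 1) ∧
    chartDeriv x (C.torsionForm (f 2)) (f 3) = chartDeriv x (C.torsionForm (f 3)) (f 2) ∧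
    chartDeriv x (C.torsionForm (f 3)) (f 1) = chartDeriv x (C.torsionForm (f 1)) (f 3) := by
  have hsq := C.epsFn_sq_frame hf hf0
  have hne : C.epsFn (f 1) (f 2) (f 3) x ≠ 0 := by
    intro h
    rw [h] at hsq
    norm_num at hsq
  have key (l c : Fin 4) (hc : c ≠ 0) := C.epsFn_mul_chartDeriv_torsionForm hf hf0 (f l) hc
  have hsym (l j k : Fin 4) (hk : k ≠ 0) := C.val_cov_coordField_comm (a := f l) (b := f j)
    (C.val_u_frame hf hf0 hk)
  have hdiv (k : Fin 3) := C.sum_div_spin hf hf0 k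
  simp only [Fin.sum_univ_three, C.spin_eq_sum_frame hf hf0 _ (C.cov _ _ _)] at hdiv
  have d1 : _ = (0 : ℝ) := hdiv 0
  have d2 : _ = (0 : ℝ) := hdiv 1
  have d3 : _ = (0 : ℝ) := hdiv 2
  have s0 : (0 : Fin 3).succ = (1 : Fin 4) := rfl
  have s1 : (1 : Fin 3).succ = (2 : Fin 4) := rfl
  have s2 : (2 : Fin 3).succ = (3 : Fin 4) := rfl
  simp only [s0, s1, s2, C.chartDeriv_spinFn_self, C.spin_apply_self,
    C.chartDeriv_spinFn_swap (f 2) (f 1), C.chartDeriv_spinFn_swap (f 3) (f 2),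
    C.chartDeriv_spinFn_swap (f 1) (f 3), C.spin_antisymm x (f 2) (f 1),
    C.spin_antisymm x (f 3) (f 2), C.spin_antisymm x (f 1) (f 3)] at d1 d2 d3
  -- The connection coefficients become formal unknowns; symmetry in the first two indices, valid
  -- for spatial third index, is all that is used of them.
  obtain ⟨P, hP⟩ : ∃ P : Fin 4 → Fin 4 → Fin 4 → ℝ, ∀ l j k,
      C.g.val x (C.cov (f l) (coordField (f j)) x) (f k) = P l j k := ⟨_, fun _ _ _ ↦ rfl⟩
  simp only [hP] at key hsym d1 d2 d3
  have k12 := key 2 1 (by decide)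
  have k21 := key 1 2 (by decide)
  have k23 := key 3 2 (by decide)
  have k32 := key 2 3 (by decide)
  have k31 := key 1 3 (by decide)
  have k13 := key 3 1 (by decide)
  simp only [hsym 2 1 _ (show (1 : Fin 4) ≠ 0 by decide),
    hsym 2 1 _ (show (2 : Fin 4) ≠ 0 by decide), hsym 2 1 _ (show (3 : Fin 4) ≠ 0 by decide),
    hsym 3 2 _ (show (1 : Fin 4) ≠ 0 by decide),
    hsym 3 2 _ (show (2 : Fin 4) ≠ 0 by decide), hsym 3 2 _ (show (3 : Fin 4) ≠ 0 by decide),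
    hsym 1 3 _ (show (1 : Fin 4) ≠ 0 by decide),
    hsym 1 3 _ (show (2 : Fin 4) ≠ 0 by decide), hsym 1 3 _ (show (3 : Fin 4) ≠ 0 by decide)]
    at k12 k21 k23 k32 k31 k13 d1 d2 d3
  simp only [Fin.reduceEq, if_true, if_false] at k12 k21 k23 k32 k31 k13
  -- Up to the volume factor, the curl in the plane of two frame vectors is the divergence of the
  -- spin density along the third.
  refine ⟨mul_left_cancel₀ hne ?_, mul_left_cancel₀ hne ?_, mul_left_cancel₀ hne ?_⟩
  · linear_combination k12 - k21 - d3
  · linear_combination k23 - k32 - d1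
  · linear_combination k31 - k13 - d2

end Frame

lemma torsionForm_add {a b : TangentSpace (𝓡 4) x}
    (hy : y ∈ (chartAt (EuclideanSpace ℝ (Fin 4)) x).source) :
    C.torsionForm (a + b) y = C.torsionForm a y + C.torsionForm b y := by
  rw [torsionForm, coordField_add a b hy, map_add, torsionForm, torsionForm]

lemma torsionForm_smul (r : ℝ) {a : TangentSpace (𝓡 4) x}
    (hy : y ∈ (chartAt (EuclideanSpace ℝ (Fin 4)) x).source) :
    C.torsionForm (r • a) y = r * C.torsionForm a y := by
  rw [torsionForm, coordField_smul r a hy, map_smul, torsionForm, smul_eq_mul]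

lemma chartDeriv_torsionForm_add [T2Space M] (a b l : TangentSpace (𝓡 4) x) :
    chartDeriv x (C.torsionForm (a + b)) l
      = chartDeriv x (C.torsionForm a) l + chartDeriv x (C.torsionForm b) l := by
  refine Eq.trans ?_ (RiemannCartan.chartDeriv_add (C.mdifferentiableAt_torsionForm a)
    (C.mdifferentiableAt_torsionForm b) l)
  refine DFunLike.congr_fun (chartDeriv_congr ?_) l
  filter_upwards [(chartAt (EuclideanSpace ℝ (Fin 4)) x).open_source.mem_nhds
    (mem_chart_source _ x)] with y hy
  exact C.torsionForm_add hy

lemma chartDeriv_torsionForm_smul [T2Space M] (r : ℝ) (a l : TangentSpace (𝓡 4) x) :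
    chartDeriv x (C.torsionForm (r • a)) l = r * chartDeriv x (C.torsionForm a) l := by
  rw [← chartDeriv_const_mul r (C.mdifferentiableAt_torsionForm a)]
  refine DFunLike.congr_fun (chartDeriv_congr ?_) l
  filter_upwards [(chartAt (EuclideanSpace ℝ (Fin 4)) x).open_source.mem_nhds
    (mem_chart_source _ x)] with y hy
  exact C.torsionForm_smul r hy

/-- The torsion form is closed on the orthogonal complement of `u`. -/
theorem chartDeriv_torsionForm_comm [T2Space M] {a b : TangentSpace (𝓡 4) x}
    (ha : C.g.val x a (C.u x) = 0) (hb : C.g.val x b (C.u x) = 0) :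
    chartDeriv x (C.torsionForm a) b = chartDeriv x (C.torsionForm b) a := by
  obtain ⟨f, hf, hf0⟩ := LorentzMetric.exists_isOrthonormal_zero_eq (g := C.g) (C.u x) (C.u_unit x)
  obtain ⟨h12, h23, h31⟩ := C.chartDeriv_torsionForm_frame hf hf0
  have expand {a : TangentSpace (𝓡 4) x} (ha : C.g.val x a (C.u x) = 0) :
      ∃ r s t : ℝ, a = r • f 1 + s • f 2 + t • f 3 := by
    refine ⟨C.g.val x a (f 1), C.g.val x a (f 2), C.g.val x a (f 3), ?_⟩
    conv_lhs => rw [← hf.sum_eq a]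
    simp [Fin.sum_univ_four, hf0, ha, eta]
  have hR (c : TangentSpace (𝓡 4) x) (r s t : ℝ) :
      chartDeriv x (C.torsionForm c) (r • f 1 + s • f 2 + t • f 3)
        = r * chartDeriv x (C.torsionForm c) (f 1) + s * chartDeriv x (C.torsionForm c) (f 2)
          + t * chartDeriv x (C.torsionForm c) (f 3) := by
    have e (L : EuclideanSpace ℝ (Fin 4) →L[ℝ] ℝ) (p q m : EuclideanSpace ℝ (Fin 4)) :
        L (r • p + s • q + t • m) = r * L p + s * L q + t * L m := by simp
    exact e _ _ _ _
  obtain ⟨r, s, t, rfl⟩ := expand ha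
  obtain ⟨r', s', t', rfl⟩ := expand hb
  rw [hR, hR]
  simp only [C.chartDeriv_torsionForm_add, C.chartDeriv_torsionForm_smul]
  rw [h12, h23, h31]
  ring

end SpinningCosmology

end ClosedForm

/-! ### Gluing local functions over a simply connected space -/

section LocalToGlobal

/-- The real line with the discrete topology. -/
def DiscreteReal : Type := ℝ

instance : TopologicalSpace DiscreteReal := ⊥

instance : DiscreteTopology DiscreteReal := ⟨rfl⟩

variable {X : Type w} [TopologicalSpace X]

/-- The bundle of germs of functions that differ from given local functions by locally constant
functions. -/
def germBundle (U : X → Set X) (hU : ∀ i, IsOpen (U i)) (hmem : ∀ i, i ∈ U i) (F : X → X → ℝ)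
    (hF : ∀ i j, ∀ y ∈ U i ∩ U j, ∀ᶠ z in nhds y, F i z - F j z = F i y - F j y) :
    FiberBundleCore X X DiscreteReal where
  baseSet := U
  isOpen_baseSet := hU
  indexAt := id
  mem_baseSet_at := hmem
  coordChange i j x v := (show ℝ from v) + (F i x - F j x)
  coordChange_self i x _ v := by
    rw [sub_self]
    exact add_zero (show ℝ from v)
  continuousOn_coordChange i j := by
    rintro ⟨y, v⟩ ⟨hy, -⟩
    refine ContinuousAt.continuousWithinAt ?_
    -- The fibre is discrete and `F i - F j` is locally constant, so the coordinate change is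
    -- locally constant.
    have hc : ContinuousAt (fun _ : X × DiscreteReal ↦
      (show DiscreteReal from (show ℝ from v) + (F i y - F j y))) (y, v) := continuousAt_const
    refine hc.congr ?_
    rw [nhds_prod_eq, nhds_discrete DiscreteReal]
    have h1 := (hF i j y hy).prod_inl (pure v : Filter DiscreteReal)
    have h2 : ∀ᶠ p : X × DiscreteReal in nhds y ×ˢ pure v, p.2 = v :=
      (show ∀ᶠ w in (pure v : Filter DiscreteReal), w = v from rfl).prod_inr _
    filter_upwards [h1, h2] with p hp1 hp2
    rw [hp1, hp2]
  coordChange_comp i j k x _ v := by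
    change ((show ℝ from v) + (F i x - F j x)) + (F j x - F k x) = (show ℝ from v) + (F i x - F k x)
    ring

/-- On a simply connected, locally path connected space, local functions that differ by locally
constant functions glue to a global one, up to locally constant functions. -/
theorem exists_glue_of_locally_constant_sub [SimplyConnectedSpace X] [LocallyPathConnectedSpace X]
    (U : X → Set X) (hU : ∀ i, IsOpen (U i)) (hmem : ∀ i, i ∈ U i) (F : X → X → ℝ)
    (hF : ∀ i j, ∀ y ∈ U i ∩ U j, ∀ᶠ z in nhds y, F i z - F j z = F i y - F j y) :
    ∃ f : X → ℝ, ∀ i, ∃ c : ℝ, ∀ᶠ z in nhds i, f z = F i z + c := by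
  let Z := germBundle U hU hmem F hF
  have hcov : IsCoveringMap (Bundle.TotalSpace.proj : Z.TotalSpace → X) :=
    FiberBundle.isCoveringMap (F := DiscreteReal) (E := Z.Fiber)
  have x₀ : X := Classical.arbitrary X
  -- The total space is a covering since the fibre is discrete. Simple connectedness lifts the
  -- identity to a global section.
  obtain ⟨s, ⟨-, hs⟩, -⟩ := hcov.existsUnique_continuousMap_lifts (ContinuousMap.id X) x₀
    (⟨x₀, (show DiscreteReal from (0 : ℝ))⟩ : Z.TotalSpace) rfl
  have hs' (x : X) : (s x).1 = x := congrFun hs x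
  -- A fibre coordinate `v` in the trivialization `i` stands for the germ of `F i + v`. The fibre
  -- over `x` is written in the trivialization of index `x`, hence the diagonal value of `F`.
  refine ⟨fun x ↦ F (s x).1 (s x).1 + (show ℝ from (s x).2), fun i ↦ ?_⟩
  have hmap : ∀ z, (Z.localTriv i (s z)).2
      = (show ℝ from (s z).2) + (F (s z).1 (s z).1 - F i (s z).1) := fun z ↦ rfl
  have hc : ContinuousAt (fun z ↦ (Z.localTriv i (s z)).2) i := by
    have h1 : ContinuousAt (Z.localTriv i) (s i) := by
      refine (Z.localTriv i).continuousAt ?_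
      rw [Z.mem_localTriv_source]
      rw [hs' i]
      exact hmem i
    exact continuousAt_snd.comp (ContinuousAt.comp (f := s) h1 s.continuous.continuousAt)
  have hev : ∀ᶠ z in nhds i, (Z.localTriv i (s z)).2 = (Z.localTriv i (s i)).2 := by
    have h := hc.tendsto
    rw [nhds_discrete DiscreteReal, Filter.tendsto_pure] at h
    exact h
  refine ⟨(show ℝ from (Z.localTriv i (s i)).2), ?_⟩
  filter_upwards [hev] with z hz
  have h := hmap z
  rw [hz] at h
  have h2 : (show ℝ from (Z.localTriv i (s i)).2)
    = (show ℝ from (s z).2) + (F (s z).1 (s z).1 - F i (s z).1) := h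
  rw [h2, hs' z]
  ring

end LocalToGlobal

/-! ### Global primitives from local ones -/

section Primitive

variable {n : ℕ} {V : Type w} [TopologicalSpace V] [ChartedSpace (EuclideanSpace ℝ (Fin n)) V]
  [IsManifold (𝓡 n) ∞ V]

/-- A function whose differential vanishes near a point is constant near that point. -/
lemma eventually_eq_of_hasMFDerivAt_zero {h : V → ℝ} {y : V}
    (hh : ∀ᶠ z in nhds y, HasMFDerivAt (𝓡 n) 𝓘(ℝ) h z 0) : ∀ᶠ z in nhds y, h z = h y := by
  set ψ := extChartAt (𝓡 n) y
  have hc : ContinuousAt ψ.symm (ψ y) := continuousAt_extChartAt_symm y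
  have hsymm : ψ.symm (ψ y) = y := extChartAt_to_inv y
  have h1 : ∀ᶠ ζ in nhds (ψ y), HasMFDerivAt (𝓡 n) 𝓘(ℝ) h (ψ.symm ζ) 0 :=
    hc.eventually (by rwa [hsymm])
  have h2 : ∀ᶠ ζ in nhds (ψ y), ζ ∈ ψ.target := extChartAt_target_mem_nhds y
  obtain ⟨ε, hε, hball⟩ := Metric.eventually_nhds_iff_ball.1 (h1.and h2)
  have hd (ζ) (hζ : ζ ∈ Metric.ball (ψ y) ε) : HasFDerivAt (𝕜 := ℝ) (h ∘ ψ.symm) 0 ζ := by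
    have h3 := (hball ζ hζ).1.comp ζ
      (mdifferentiableAt_extChartAt_symm' (x := y) (hball ζ hζ).2).hasMFDerivAt
    rw [ContinuousLinearMap.zero_comp] at h3
    exact h3.hasFDerivAt
  have hconst : ∀ ζ ∈ Metric.ball (ψ y) ε, (h ∘ ψ.symm) ζ = (h ∘ ψ.symm) (ψ y) := by
    intro ζ hζ
    refine (convex_ball (ψ y) ε).is_const_of_fderivWithin_eq_zero (𝕜 := ℝ)
      (fun w hw ↦ (hd w hw).differentiableAt.differentiableWithinAt) (fun w hw ↦ ?_) hζ
      (Metric.mem_ball_self hε)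
    rw [fderivWithin_of_isOpen Metric.isOpen_ball hw]
    exact (hd w hw).fderiv
  have hψ : ContinuousAt ψ y := continuousAt_extChartAt y
  filter_upwards [hψ (Metric.ball_mem_nhds _ hε), extChartAt_source_mem_nhds (I := 𝓡 n) y]
    with z hz hzs
  have := hconst (ψ z) hz
  simpa [ψ.left_inv hzs, hsymm] using this

/-- A 1-form with local primitives on a simply connected manifold has a global primitive. -/
theorem exists_hasMFDerivAt_of_locally [SimplyConnectedSpace V]
    (η : ∀ y : V, TangentSpace (𝓡 n) y →L[ℝ] ℝ)
    (hη : ∀ y, ∃ f : V → ℝ, ∀ᶠ z in nhds y, HasMFDerivAt (𝓡 n) 𝓘(ℝ) f z (η z)) :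
    ∃ f : V → ℝ, ∀ y, HasMFDerivAt (𝓡 n) 𝓘(ℝ) f y (η y) := by
  have : LocallyPathConnectedSpace V :=
    ChartedSpace.locallyPathConnectedSpace (EuclideanSpace ℝ (Fin n)) V
  choose F hF using hη
  choose U hU hUo hUm using fun y ↦ eventually_nhds_iff.1 (hF y)
  -- Two local primitives of the same form differ by a function with zero differential.
  obtain ⟨f, hf⟩ := exists_glue_of_locally_constant_sub U hUo hUm F (by
    rintro i j y ⟨hi, hj⟩
    refine eventually_eq_of_hasMFDerivAt_zero (n := n) (h := fun z ↦ F i z - F j z) ?_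
    filter_upwards [(hUo i).mem_nhds hi, (hUo j).mem_nhds hj] with z hzi hzj
    have := (hU i z hzi).sub (hU j z hzj)
    rwa [sub_self] at this)
  refine ⟨f, fun y ↦ ?_⟩
  obtain ⟨c, hc⟩ := hf y
  have h1 := (hU y y (hUm y)).add (hasMFDerivAt_const (I := 𝓡 n) (I' := 𝓘(ℝ)) c y)
  have h2 := h1.congr_of_eventuallyEq (f₁ := f) hc
  exact (add_zero (η y)) ▸ h2

end Primitive

/-! ### Pullback of the torsion form along maps orthogonal to `u` -/

section Pullback

variable {M : Type v} [TopologicalSpace M]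
  [ChartedSpace (EuclideanSpace ℝ (Fin 4)) M] [IsManifold (𝓡 4) ∞ M] {x y : M}

namespace SpinningCosmology

variable (C : SpinningCosmology M)

lemma torsionForm_eq_sum (c : EuclideanSpace ℝ (Fin 4))
    (hy : y ∈ (chartAt (EuclideanSpace ℝ (Fin 4)) x).source) :
    C.torsionForm (x := x) c y
      = ∑ i, C.torsionForm (x := x) (EuclideanSpace.single i (1 : ℝ)) y * c i := by
  let L : EuclideanSpace ℝ (Fin 4) →ₗ[ℝ] ℝ :=
    { toFun := fun c ↦ C.torsionForm (x := x) c y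
      map_add' := fun a b ↦ C.torsionForm_add hy
      map_smul' := fun r a ↦ C.torsionForm_smul r hy }
  have h := (EuclideanSpace.basisFun (Fin 4) ℝ).sum_repr c
  have h2 : L c = ∑ i, L (EuclideanSpace.single i (1 : ℝ)) * c i := by
    conv_lhs => rw [← h]
    simp [mul_comm]
  exact h2

lemma chartDeriv_torsionForm_eq_sum [T2Space M] (c l : EuclideanSpace ℝ (Fin 4)) :
    chartDeriv x (C.torsionForm (x := x) c) l
      = ∑ i, chartDeriv x (C.torsionForm (x := x) (EuclideanSpace.single i (1 : ℝ))) l * c i := by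
  let L : EuclideanSpace ℝ (Fin 4) →ₗ[ℝ] ℝ :=
    { toFun := fun c ↦ chartDeriv x (C.torsionForm (x := x) c) l
      map_add' := fun a b ↦ C.chartDeriv_torsionForm_add (x := x) a b l
      map_smul' := fun r a ↦ C.chartDeriv_torsionForm_smul (x := x) r a l }
  have h := (EuclideanSpace.basisFun (Fin 4) ℝ).sum_repr c
  have h2 : L c = ∑ i, L (EuclideanSpace.single i (1 : ℝ)) * c i := by
    conv_lhs => rw [← h]
    simp [mul_comm]
  exact h2

/-- The pull back of the torsion form by a map from a vector space. -/
def pullbackForm {E : Type*} [NormedAddCommGroup E] [NormedSpace ℝ E] (F : E → M) (ζ : E) :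
    E →L[ℝ] ℝ :=
  (C.g.val (F ζ) (C.torsionVector C.u (F ζ))).comp (mfderiv 𝓘(ℝ, E) (𝓡 4) F ζ)

/-- The pull back of the torsion form by a map with values orthogonal to `u` is closed. -/
theorem exists_hasFDerivAt_pullbackForm [T2Space M] {E : Type*} [NormedAddCommGroup E]
    [NormedSpace ℝ E] {F : E → M} {ζ₀ : E} (hF : ContMDiffAt 𝓘(ℝ, E) (𝓡 4) ∞ F ζ₀)
    (hu : ∀ v : E, C.g.val (F ζ₀) (mfderiv 𝓘(ℝ, E) (𝓡 4) F ζ₀ v) (C.u (F ζ₀)) = 0) :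
    ∃ D : E →L[ℝ] E →L[ℝ] ℝ, HasFDerivAt (C.pullbackForm F) D ζ₀ ∧ ∀ v w, D v w = D w v := by
  set x := F ζ₀ with hx
  set φ := extChartAt (𝓡 4) x with hφ
  set G : E → EuclideanSpace ℝ (Fin 4) := φ ∘ F with hG
  have hGs : ContDiffAt ℝ ∞ G ζ₀ := by
    rw [← contMDiffAt_iff_contDiffAt]
    exact (contMDiffAt_extChartAt (I := 𝓡 4) (x := x)).comp ζ₀ hF
  have hGd : DifferentiableAt ℝ G ζ₀ := hGs.differentiableAt (by simp)
  have hG2 : DifferentiableAt ℝ (fderiv ℝ G) ζ₀ :=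
    (hGs.fderiv_right (m := 1) (right_eq_inf.mp rfl)).differentiableAt (by simp)
  have hsymm : IsSymmSndFDerivAt ℝ G ζ₀ :=
    hGs.isSymmSndFDerivAt (by rw [minSmoothness_of_isRCLikeNormedField]; exact ENat.LEInfty.out)
  have h1 : ∀ᶠ ζ in nhds ζ₀, DifferentiableAt ℝ G ζ := by
    have := (hGs.of_le (show (1 : WithTop ℕ∞) ≤ ∞ from ENat.LEInfty.out)).eventually (by simp)
    exact this.mono fun ζ h ↦ h.differentiableAt (by simp)
  have h2 : ∀ᶠ ζ in nhds ζ₀, F ζ ∈ (chartAt (EuclideanSpace ℝ (Fin 4)) x).source :=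
    hF.continuousAt ((chartAt (EuclideanSpace ℝ (Fin 4)) x).open_source.mem_nhds
      (mem_chart_source _ x))
  have hdF : ∀ᶠ ζ in nhds ζ₀, ∀ v : E,
      mfderiv 𝓘(ℝ, E) (𝓡 4) F ζ v = coordField (x := x) (fderiv ℝ G ζ v) (F ζ) := by
    filter_upwards [h1, h2, h2.eventually_nhds] with ζ hζ1 hζ2 hζ3 v
    have hs : G ζ ∈ φ.target := φ.map_source (by rwa [hφ, extChartAt_source])
    have h3 := (mdifferentiableAt_extChartAt_symm' (x := x) hs).hasMFDerivAt.comp ζ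
      hζ1.hasFDerivAt.hasMFDerivAt
    have h4 : F =ᶠ[nhds ζ] φ.symm ∘ G := by
      filter_upwards [hζ3] with z hz
      exact (φ.left_inv (by rwa [hφ, extChartAt_source])).symm
    have h5 := (h3.congr_of_eventuallyEq h4).mfderiv
    exact (DFunLike.congr_fun h5 v).trans (coordField_eq_mfderiv (x := x) _ hζ2).symm
  set e : Fin 4 → EuclideanSpace ℝ (Fin 4) := fun i ↦ EuclideanSpace.single i (1 : ℝ)
  set pr : Fin 4 → EuclideanSpace ℝ (Fin 4) →L[ℝ] ℝ := fun i ↦ EuclideanSpace.proj i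
  set t : Fin 4 → EuclideanSpace ℝ (Fin 4) → ℝ :=
    fun i ↦ C.torsionForm (x := x) (e i) ∘ φ.symm
  have ht (i : Fin 4) : HasFDerivAt (t i) (chartDeriv x (C.torsionForm (x := x) (e i))) (G ζ₀) :=
    hasFDerivAt_chartDeriv (C.mdifferentiableAt_torsionForm _)
  -- In chart coordinates the pullback is the sum of the components `t i ∘ G` times the
  -- differentials of the components of `G`.
  have hev : C.pullbackForm F =ᶠ[nhds ζ₀]
      fun ζ ↦ ∑ i, t i (G ζ) • (pr i).comp (fderiv ℝ G ζ) := by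
    filter_upwards [hdF, h2] with ζ hζ1 hζ2
    ext v
    have h3 : C.pullbackForm F ζ v = C.torsionForm (x := x) (fderiv ℝ G ζ v) (F ζ) :=
      congrArg (C.g.val (F ζ) (C.torsionVector C.u (F ζ))) (hζ1 v)
    have h4 : φ.symm (G ζ) = F ζ := φ.left_inv (by rwa [hφ, extChartAt_source])
    rw [h3, C.torsionForm_eq_sum _ hζ2, sum_apply]
    refine Finset.sum_congr rfl fun i _ ↦ ?_
    change _ = C.torsionForm (x := x) (e i) (φ.symm (G ζ)) * fderiv ℝ G ζ v i
    rw [h4]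
  have hD (i : Fin 4) := ((ht i).comp ζ₀ hGd.hasFDerivAt).smul
    ((ContinuousLinearMap.compL ℝ E _ ℝ (pr i)).hasFDerivAt.comp ζ₀ hG2.hasFDerivAt)
  have hsum := HasFDerivAt.fun_sum (u := Finset.univ) fun i _ ↦ hD i
  refine ⟨_, hsum.congr_of_eventuallyEq hev, fun v w ↦ ?_⟩
  -- The terms with a second derivative of `G` are symmetric. The remaining ones are symmetric by
  -- closedness, since the image of the differential at `ζ₀` is orthogonal to `u`.
  have key (v w : E) : chartDeriv x (C.torsionForm (x := x) (fderiv ℝ G ζ₀ w)) (fderiv ℝ G ζ₀ v)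
      = chartDeriv x (C.torsionForm (x := x) (fderiv ℝ G ζ₀ v)) (fderiv ℝ G ζ₀ w) := by
    have hperp (v : E) : C.g.val x (show EuclideanSpace ℝ (Fin 4) from fderiv ℝ G ζ₀ v) (C.u x)
        = 0 := by
      have h3 := (hdF.self_of_nhds v).trans (coordField_self (x := x) _)
      exact (congrArg (fun a ↦ C.g.val x a (C.u x)) h3).symm.trans (hu v)
    exact C.chartDeriv_torsionForm_comm (x := x) (hperp w) (hperp v)
  have hk := key v w
  rw [C.chartDeriv_torsionForm_eq_sum, C.chartDeriv_torsionForm_eq_sum] at hk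
  simp only [sum_apply, add_apply, smul_apply, ContinuousLinearMap.smulRight_apply,
    Finset.sum_add_distrib, Function.comp_apply, ContinuousLinearMap.coe_comp,
    ContinuousLinearMap.compL_apply, smul_eq_mul]
  rw [hsymm v w]
  exact congrArg (_ + ·) hk

end SpinningCosmology

end Pullback

/-! ### The torsion form on an orthogonal hypersurface -/

section Slice

variable {M : Type v} [TopologicalSpace M] [T2Space M]
  [ChartedSpace (EuclideanSpace ℝ (Fin 4)) M] [IsManifold (𝓡 4) ∞ M] {C : SpinningCosmology M}
  {V : Type w} [TopologicalSpace V] [ChartedSpace (EuclideanSpace ℝ (Fin 3)) V]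
  [IsManifold (𝓡 3) ∞ V] {ι : V → M}

namespace IsOrthogonalSlice

/-- The torsion form has local primitives on an orthogonal slice. -/
lemma exists_local_primitive (hι : IsOrthogonalSlice C ι) (y : V) :
    ∃ f : V → ℝ, ∀ᶠ z in nhds y, HasMFDerivAt (𝓡 3) 𝓘(ℝ) f z
      ((C.g.val (ι z) (C.torsionVector C.u (ι z))).comp (mfderiv (𝓡 3) (𝓡 4) ι z)) := by
  set ψ := extChartAt (𝓡 3) y with hψ
  set F : EuclideanSpace ℝ (Fin 3) → M := ι ∘ ψ.symm with hF
  have hιd (z : V) : MDifferentiableAt (𝓡 3) (𝓡 4) ι z := hι.smooth.mdifferentiable (by simp) z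
  obtain ⟨ε, hε, hball⟩ := Metric.mem_nhds_iff.1 (extChartAt_target_mem_nhds (I := 𝓡 3) y)
  have hcl (ζ) (hζ : ζ ∈ Metric.ball (ψ y) ε) := by
    refine C.exists_hasFDerivAt_pullbackForm (F := F) (ζ₀ := ζ) ?_ fun v ↦ ?_
    · have h := contMDiffOn_extChartAt_symm (I := 𝓡 3) (n := ∞) y
      have h2 : ContMDiffAt 𝓘(ℝ, EuclideanSpace ℝ (Fin 3)) (𝓡 3) ∞ ψ.symm ζ :=
        h.contMDiffAt (Filter.mem_of_superset (Metric.isOpen_ball.mem_nhds hζ) hball)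
      exact (hι.smooth _).comp ζ h2
    · have h := mfderiv_comp (I' := 𝓡 3) ζ (hιd (ψ.symm ζ))
        (mdifferentiableAt_extChartAt_symm' (x := y) (hball hζ))
      have h2 := DFunLike.congr_fun h v
      exact (congrArg (fun a ↦ C.g.val (F ζ) a (C.u (F ζ))) h2).trans
        ((hι.tangent (ψ.symm ζ) _).1 ⟨_, rfl⟩)
  have hdiff : DifferentiableOn ℝ (C.pullbackForm F) (Metric.ball (ψ y) ε) := fun ζ hζ ↦ by
    obtain ⟨D, hD, -⟩ := hcl ζ hζ
    exact hD.differentiableAt.differentiableWithinAt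
  -- The Poincaré lemma for 1-forms, on a ball inside the chart target.
  obtain ⟨f, hf⟩ := (convex_ball (ψ y) ε).exists_forall_hasFDerivAt_of_fderiv_symmetric
    Metric.isOpen_ball hdiff fun ζ hζ v w ↦ by
      obtain ⟨D, hD, hs⟩ := hcl ζ hζ
      rw [hD.fderiv, hs]
  refine ⟨f ∘ ψ, ?_⟩
  have hc : ContinuousAt ψ y := continuousAt_extChartAt y
  have hs := eventually_mem_nhds_iff.2 (extChartAt_source_mem_nhds (I := 𝓡 3) y)
  filter_upwards [hc (Metric.ball_mem_nhds _ hε), hs] with z hz hzn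
  have hzs : z ∈ ψ.source := mem_of_mem_nhds hzn
  have hψd := (mdifferentiableAt_extChartAt (I := 𝓡 3) (x := y)
    (by rwa [← extChartAt_source (𝓡 3)])).hasMFDerivAt
  have h1 := (hf (ψ z) hz).hasMFDerivAt.comp z hψd
  have hFd : MDifferentiableAt 𝓘(ℝ, EuclideanSpace ℝ (Fin 3)) (𝓡 4) F (ψ z) :=
    (hιd _).comp (ψ z) (mdifferentiableAt_extChartAt_symm' (x := y) (hball hz))
  have h2 := hFd.hasMFDerivAt.comp z hψd
  have h3 : ι =ᶠ[nhds z] F ∘ ψ := by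
    filter_upwards [hzn] with p hp
    exact congrArg ι (ψ.left_inv hp).symm
  have h4 := (h2.congr_of_eventuallyEq h3).mfderiv
  have h5 : F (ψ z) = ι z := h3.self_of_nhds.symm
  have h6 : (show EuclideanSpace ℝ (Fin 4) →L[ℝ] ℝ from
      C.g.val (F (ψ z)) (C.torsionVector C.u (F (ψ z))))
      = C.g.val (ι z) (C.torsionVector C.u (ι z)) := by
    rw [h5]
  have h7 : (C.pullbackForm F (ψ z)).comp (mfderiv (𝓡 3) 𝓘(ℝ, EuclideanSpace ℝ (Fin 3)) ψ z)
      = (C.g.val (ι z) (C.torsionVector C.u (ι z))).comp (mfderiv (𝓡 3) (𝓡 4) ι z) := by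
    ext v
    exact (DFunLike.congr_fun h6 _).trans (congrArg (C.g.val (ι z) (C.torsionVector C.u (ι z)))
      (DFunLike.congr_fun h4 v).symm)
  exact h7 ▸ h1

/-- The torsion form has a primitive on a simply connected orthogonal slice. -/
lemma exists_primitive [SimplyConnectedSpace V] (hι : IsOrthogonalSlice C ι) :
    ∃ f : V → ℝ, ∀ y, HasMFDerivAt (𝓡 3) 𝓘(ℝ) f y
      ((C.g.val (ι y) (C.torsionVector C.u (ι y))).comp (mfderiv (𝓡 3) (𝓡 4) ι y)) :=
  exists_hasMFDerivAt_of_locally (n := 3) (V := V) _ hι.exists_local_primitive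

end IsOrthogonalSlice

/-- The differential of a function vanishes at a global maximum. -/
lemma hasMFDerivAt_eq_zero_of_isMaxOn {n : ℕ} {V : Type w} [TopologicalSpace V]
    [ChartedSpace (EuclideanSpace ℝ (Fin n)) V] [IsManifold (𝓡 n) ∞ V] {f : V → ℝ} {y : V}
    {f' : TangentSpace (𝓡 n) y →L[ℝ] ℝ} (hf : HasMFDerivAt (𝓡 n) 𝓘(ℝ) f y f')
    (hmax : ∀ z, f z ≤ f y) : f' = 0 := by
  set ψ := extChartAt (𝓡 n) y with hψ
  have h := hf.2
  rw [ModelWithCorners.range_eq_univ] at h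
  replace h := hasFDerivWithinAt_univ.1 h
  refine IsLocalMax.hasFDerivAt_eq_zero (Filter.Eventually.of_forall fun ζ ↦ ?_) h
  change f (ψ.symm ζ) ≤ f (ψ.symm (ψ y))
  rw [extChartAt_to_inv]
  exact hmax _

end Slice

end

end EinsteinCartan

theorem theorem2 {M : Type*} [TopologicalSpace M] [T2Space M]
    [ChartedSpace (EuclideanSpace ℝ (Fin 4)) M] [IsManifold (𝓡 4) ∞ M]
    (C : EinsteinCartan.SpinningCosmology M)
    {V : Type*} [TopologicalSpace V] [ChartedSpace (EuclideanSpace ℝ (Fin 3)) V]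
    [IsManifold (𝓡 3) ∞ V] [SimplyConnectedSpace V]
    (ι : V → M) (hι : EinsteinCartan.IsOrthogonalSlice C ι)
    (hS : ∀ y : V, C.g.val (ι y) (C.torsionVector C.u (ι y)) (C.torsionVector C.u (ι y)) ≠ 0) :
    ¬ CompactSpace V := by
  intro hV
  obtain ⟨f, hf⟩ := hι.exists_primitive
  have hcont : Continuous f := continuous_iff_continuousAt.2 fun y ↦ (hf y).continuousAt
  obtain ⟨y, -, hy⟩ := isCompact_univ.exists_isMaxOn Set.univ_nonempty hcont.continuousOn
  have h0 := EinsteinCartan.hasMFDerivAt_eq_zero_of_isMaxOn (hf y) fun z ↦ hy (Set.mem_univ z)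
  -- The torsion vector is orthogonal to `u`, hence tangent to the hypersurface; the differential of
  -- the primitive on it is its own square, which must vanish at the maximum.
  obtain ⟨v, hv⟩ := (hι.tangent y _).2 (C.val_torsionVector_u (ι y))
  have h1 := DFunLike.congr_fun h0 v
  rw [ContinuousLinearMap.comp_apply, hv] at h1
  exact hS y h1
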